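/- **Conventions.** Let $\mathbb N=\{1,2,\dots\}$ and $[n]=\{1,\dots,n\}$. For $R\subseteq\mathbb N$ and $n,k\ge 1$ let ${n \brace k}_R$, ${n \brack k}_R$ and $L(n,k)_R$ be the numbers of (unordered) partitions of $[n]$ into $k$ non-empty subsets, cycles (cyclically ordered sets) and lists (linearly ordered sets), respectively, all of whose cardinalities lie in $R$. Let ${n \brace k}_R^{-1}$, ${n \brack k}_R^{-1}$ and $L(n,k)_R^{-1}$ be the entries in row $n$ and column $k$ of the inverses of the infinite matrices $[{n \brace k}_R]_{n,k\ge1}$, $[{n \brack k}_R]_{n,k\ge1}$ and $[L(n,k)_R]_{n,k\ge1}$. The set $R$ *has no exposed odds* if (i) $1\in R$ implies $2\in R$, and (ii) for every odd $n\ge3$ with $n\in R$, both $n-1\in R$ and $n+1\in R$. Write $R$ as the disjoint union of its maximal intervals; $a(R)$ is the set of left endpoints of these intervals, except $1$, and $b(R)$ is the set of their right endpoints (an unbounded interval has none). Forests are unordered collections of rooted trees. The degree $d(v)$ of a vertex $v$ is its number of children; $v$ is a leaf if $d(v)=0$ (an isolated root is a leaf). A *linearly ordered phylogenetic forest* with $n$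 leaves and $k$ components is a rooted forest with $k$ components and $n$ leaves in which no vertex has degree $1$, the leaves are labeled bijectively by $[n]$, and the children of each non-leaf vertex are linearly ordered from left to right. For a vertex $v$ let $\ell_{\max}(v)$ and $\ell_{\min}(v)$ be the largest and the smallest label of a leaf descended from $v$ (a leaf is descended from itself). The forest is *increasingly ordered* if $\ell_{\max}$ increases from left to right along the children of every non-leaf vertex, and *min-first ordered* if the left-most child of every non-leaf vertex has the smallest $\ell_{\min}$ among its siblings. A vertex $v$ has *$2$-left-odd ancestry* if there is a downward path $v_1,\dots,v_m=v$ with $m\geq 2$ even such that $d(v_i)=2$ and $v_{i+1}$ is the left-most child of $v_i$ for all $1\le i<m$, and $v_1$ is not the left-most child of a vertex of degree $2$. The forest is *$R$-good* if every non-leaf vertex $v$ satisfies $d(v)\in b(R)$ if $v$ has $2$-left-odd ancestry, and $d(v)=2$ or $d(v)\in a(R)$ otherwise. Let $\mathcal F_R^{\rm i.o.,good}(n,k)$, $\mathcal F_R^{\rm m.o.,good}(n,k)$ and $\mathcal F_R^{\rm l.o.,good}(n,k)$ be the sets of $R$-good increasingly ordered, min-first ordered and linearly ordered phylogenetic forests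 with $n$ leaves and $k$ components. **Theorem.** Let $R\subseteq\mathbb N$ with $1\in R$ have no exposed odds. Then the three inverse matrices exist and are unique, and for all $n,k\ge1$ $${n \brace k}^{-1}_{R} = (-1)^{n-k}\left|\mathcal F_R^{\rm i.o.,good}(n,k)\right|,\qquad {n \brack k}^{-1}_{R} = (-1)^{n-k}\left|\mathcal F_R^{\rm m.o.,good}(n,k)\right|,\qquad L(n,k)^{-1}_{R} = (-1)^{n-k}\left|\mathcal F_R^{\rm l.o.,good}(n,k)\right|.$$ -/

import Mathlib

namespace RestrictedStirling

noncomputable section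

/-! ### Sets of positive integers without exposed odds -/

/-- `R` has no exposed odds. -/
def NoExposedOdds (R : Set ℕ) : Prop :=
  (1 ∈ R → 2 ∈ R) ∧ ∀ n ∈ R, Odd n → 3 ≤ n → n - 1 ∈ R ∧ n + 1 ∈ R

/-- `I` is one of the maximal (nonempty) intervals of which `R` is the disjoint union. -/
def IsMaximalInterval (R I : Set ℕ) : Prop :=
  Maximal (fun J : Set ℕ => J.Nonempty ∧ J.OrdConnected ∧ J ⊆ R) I

/-- `a(R)`: the left endpoints, except `1`, of the maximal intervals of `R`. -/
def leftEndpoints (R : Set ℕ) : Set ℕ :=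
  {a | a ≠ 1 ∧ ∃ I, IsMaximalInterval R I ∧ IsLeast I a}

/-- `b(R)`: the right endpoints of the maximal intervals of `R` (unbounded ones have none). -/
def rightEndpoints (R : Set ℕ) : Set ℕ :=
  {b | ∃ I, IsMaximalInterval R I ∧ IsGreatest I b}

/-! ### Restricted Stirling and Lah numbers -/

/-- The number of partitions of `[n] = {1, …, n}` into `k` nonempty subsets with
cardinalities in `R`. -/
def stirlingSecond (R : Set ℕ) (n k : ℕ) : ℕ :=
  Set.ncard {P : Finpartition (Finset.Icc 1 n) |
    P.parts.card = k ∧ ∀ B ∈ P.parts, B.card ∈ R}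

/-- The number of partitions of `[n]` into `k` nonempty cycles (cyclically ordered sets) with
cardinalities in `R`. The condition on the sum of multisets says that every element
of `[n]`, and nothing else, occurs in the cycles, and that it occurs exactly once. -/
def stirlingFirst (R : Set ℕ) (n k : ℕ) : ℕ :=
  Set.ncard {C : Finset (Cycle ℕ) |
    C.card = k ∧ (∀ c ∈ C, c ≠ Cycle.nil ∧ c.length ∈ R) ∧
      ∑ c ∈ C, c.toMultiset = (Finset.Icc 1 n).val}

/-- The number of partitions of `[n]` into `k` nonempty lists (linearly ordered sets) with
cardinalities in `R`. -/
def lah (R : Set ℕ) (n k : ℕ) : ℕ :=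
  Set.ncard {C : Finset (List ℕ) |
    C.card = k ∧ (∀ l ∈ C, l ≠ [] ∧ l.length ∈ R) ∧
      ∑ l ∈ C, (l : Multiset ℕ) = (Finset.Icc 1 n).val}

/-- The infinite matrix, with rows and columns indexed by the positive integers, of a
doubly indexed family of natural numbers. -/
def infMatrix (f : ℕ → ℕ → ℕ) : Matrix ℕ+ ℕ+ ℚ :=
  Matrix.of fun n k => (f n k : ℚ)

/-- `C` is the product of the infinite matrices `A` and `B`: every entry of the product is a sum
with only finitely many nonzero terms. -/
def IsProduct (A B C : Matrix ℕ+ ℕ+ ℚ) : Prop :=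
  ∀ n k, (Function.support fun j => A n j * B j k).Finite ∧
    ∑ᶠ j, A n j * B j k = C n k

/-- `B` is a two-sided inverse of the infinite matrix `A`. -/
def IsInverse (A B : Matrix ℕ+ ℕ+ ℚ) : Prop :=
  IsProduct A B 1 ∧ IsProduct B A 1

/-! ### Leaf-labeled trees with ordered children -/

/-- Rooted trees whose leaves are labeled by natural numbers and in which the children
of each non-leaf vertex are linearly ordered, from left to right.
(`node []` is not a legitimate tree; it is excluded by `IsPhylogenetic` below.) -/
inductive OTree : Type
  | leaf (label : ℕ) : OTree
  | node (children : List OTree) : OTree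

namespace OTree

/-- The down-degree of the root. -/
def degree : OTree → ℕ
  | leaf _ => 0
  | node cs => cs.length

/-- The list of the labels of all leaves, from left to right. -/
def leaves : OTree → List ℕ
  | leaf l => [l]
  | node cs => cs.flatMap leaves

/-- The largest label of a leaf descended from the root. -/
def lmax (t : OTree) : ℕ := sSup {l | l ∈ t.leaves}

/-- The smallest label of a leaf descended from the root. -/
def lmin (t : OTree) : ℕ := sInf {l | l ∈ t.leaves}

/-- The vertices of a tree are represented by their addresses: the root is `[]`, and the `i`-th
child from the left (starting with `i = 0`) of the vertex `p` is `p ++ [i]`. The vertices of `t`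
are the `p` for which `t.subtreeAt p` is `some s`; then `s` is the subtree consisting of the
vertex `p` and its descendants. -/
def subtreeAt : OTree → List ℕ → Option OTree
  | t, [] => some t
  | leaf _, _ :: _ => none
  | node cs, i :: p => (cs[i]?).bind fun c => c.subtreeAt p

/-- `p` is a vertex of `t`, and it has down-degree `d`. -/
def HasDegreeAt (t : OTree) (p : List ℕ) (d : ℕ) : Prop :=
  ∃ s, t.subtreeAt p = some s ∧ s.degree = d

/-- Every internal vertex has children, and no vertex has down-degree `1`. -/
def IsPhylogenetic (t : OTree) : Prop :=
  ∀ p cs, t.subtreeAt p = some (node cs) → cs ≠ [] ∧ cs.length ≠ 1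

/-- For each complete set of siblings, `lmax` increases from left to right. -/
def IsIncreasing (t : OTree) : Prop :=
  ∀ p cs, t.subtreeAt p = some (node cs) → cs.Pairwise fun a b => a.lmax < b.lmax

/-- For each complete set of siblings, the left-most one has the smallest `lmin`. -/
def IsMinFirst (t : OTree) : Prop :=
  ∀ p c cs, t.subtreeAt p = some (node (c :: cs)) → ∀ b ∈ cs, c.lmin < b.lmin

/-- The vertex `p` of `t` has `2`-left-odd ancestry: there is an ancestor `q` of `p` such that
the path from `q` to `p` has an odd number `m` of edges (so an even number `m + 1` of vertices),
every vertex of the path other than `p` has down-degree `2` and is followed on the path by its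
left-most child, and `q` is not the left-most child of a vertex of down-degree `2`. -/
def HasTwoLeftOddAncestry (t : OTree) (p : List ℕ) : Prop :=
  ∃ (q : List ℕ) (m : ℕ), Odd m ∧ p = q ++ List.replicate m 0 ∧
    (∀ i < m, t.HasDegreeAt (q ++ List.replicate i 0) 2) ∧
    ¬ ∃ w : List ℕ, q = w ++ [0] ∧ t.HasDegreeAt w 2

/-- `R`-good trees. -/
def IsGood (R : Set ℕ) (t : OTree) : Prop :=
  ∀ p s, t.subtreeAt p = some s →
    (¬ t.HasTwoLeftOddAncestry p →
      s.degree = 0 ∨ s.degree = 2 ∨ s.degree ∈ leftEndpoints R) ∧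
    (t.HasTwoLeftOddAncestry p → s.degree = 0 ∨ s.degree ∈ rightEndpoints R)

end OTree

/-! ### Forests -/

/-- `F` is a linearly ordered phylogenetic forest with `k` (unordered) components and `n` leaves,
which are labeled bijectively by `1, …, n`. -/
def IsPhylogeneticForest (n k : ℕ) (F : Finset OTree) : Prop :=
  F.card = k ∧ (∀ t ∈ F, t.IsPhylogenetic) ∧
    ∑ t ∈ F, (t.leaves : Multiset ℕ) = (Finset.Icc 1 n).val

/-- The `R`-good linearly ordered phylogenetic forests with `n` leaves and `k` components. -/
def goodForestsLinear (R : Set ℕ) (n k : ℕ) : Set (Finset OTree) :=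
  {F | IsPhylogeneticForest n k F ∧ ∀ t ∈ F, t.IsGood R}

/-- The `R`-good increasingly ordered phylogenetic forests with `n` leaves and `k` components. -/
def goodForestsIncreasing (R : Set ℕ) (n k : ℕ) : Set (Finset OTree) :=
  {F | F ∈ goodForestsLinear R n k ∧ ∀ t ∈ F, t.IsIncreasing}

/-- The `R`-good min-first ordered phylogenetic forests with `n` leaves and `k` components. -/
def goodForestsMinFirst (R : Set ℕ) (n k : ℕ) : Set (Finset OTree) :=
  {F | F ∈ goodForestsLinear R n k ∧ ∀ t ∈ F, t.IsMinFirst}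

end

end RestrictedStirling

namespace RestrictedStirling

open PowerSeries

/-! ### Endpoints of the maximal intervals -/

/-! The proof works with exponential generating functions. Let `f` be the series of a single block
(set, cycle or list) with size in `R`. Column `k` of the matrix has series `f ^ k / k!`, so
inverting the matrix amounts to inverting `f` under composition: numbers with series `E ^ k / k!`
give the inverse, up to the sign (-1)^(n-k), as soon as f(-E) = -X (`inverse_of_subst_eq`).

Let `E` and `O` count good trees whose root is treated as lacking, respectively having, 2-left-odd
ancestry. This status depends only on the parity of a chain of left-most steps below binary
vertices, so splitting off the root gives E = X + O □ E + A(E) and O = X + B(E)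
(`IsOrderKind.exists_system`). Here `A` and `B` are the block series with sizes in a(R) and b(R).
The product □ is the ordinary one for linear order; otherwise it is a boxed product, which forces
the largest label into the right tree or the smallest into the left one.

The system is solved by telescoping. The difference [n+1 ∈ R] - [n ∈ R] vanishes except at endpoints
of intervals, and without exposed odds all elements of a(R) and b(R) are even. Hence in the
alternating series g(X) = f(-X) they all enter with a plus sign. For lists this reads (1+X)g = -X +
A + XB, and there are differential analogues for sets and cycles. Substituting `E` and eliminating
`A` and `B` by the system leaves f(-E) = -X (`subst_neg_eq_neg_X_of_linear`,
`subst_neg_eq_neg_X_of_maxBoxed`, `subst_neg_eq_neg_X_of_minBoxed`). -/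

theorem isMaximalInterval_ordConnectedComponent {R : Set ℕ} {a : ℕ} (ha : a ∈ R) :
    IsMaximalInterval R (R.ordConnectedComponent a) := by
  refine ⟨⟨⟨a, Set.self_mem_ordConnectedComponent.2 ha⟩, inferInstance,
    Set.ordConnectedComponent_subset⟩, ?_⟩
  rintro J ⟨-, hJ, hJR⟩ hle
  exact Set.subset_ordConnectedComponent (hle (Set.self_mem_ordConnectedComponent.2 ha)) hJR

/-- Adjoining `a - 1` to the interval would contradict its maximality. The hypothesis `0 ∉ R`
matters because truncated subtraction gives `0 - 1 = 0`. -/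
theorem mem_leftEndpoints {R : Set ℕ} (h0 : 0 ∉ R) {a : ℕ} :
    a ∈ leftEndpoints R ↔ a ≠ 1 ∧ a ∈ R ∧ a - 1 ∉ R := by
  refine and_congr_right fun _ => ⟨?_, ?_⟩
  · rintro ⟨I, ⟨⟨hne, hI, hIR⟩, hmax⟩, haI, hleast⟩
    refine ⟨hIR haI, fun h => ?_⟩
    have ha0 : a ≠ 0 := fun h => h0 (h ▸ hIR haI)
    have hJ : (insert (a - 1) I).OrdConnected := by
      refine ⟨fun x hx y hy z hz => ?_⟩
      rcases eq_or_ne z (a - 1) with rfl | hz'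
      · exact Set.mem_insert _ _
      have hxa : a - 1 ≤ x := by
        rcases hx with rfl | hx
        · exact le_rfl
        · exact (Nat.sub_le _ _).trans (hleast hx)
      have haz : a ≤ z := by have := hz.1; omega
      rcases hy with rfl | hy
      · have := hz.2; omega
      · exact Or.inr (hI.out haI hy ⟨haz, hz.2⟩)
    have := hmax ⟨⟨a, Or.inr haI⟩, hJ, Set.insert_subset h hIR⟩ (Set.subset_insert _ _)
      (Set.mem_insert _ _)
    have := hleast this
    omega
  · rintro ⟨haR, h⟩
    refine ⟨_, isMaximalInterval_ordConnectedComponent haR,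
      Set.self_mem_ordConnectedComponent.2 haR, fun x hx => ?_⟩
    by_contra! hlt
    exact h (hx (by rw [Set.uIcc_comm, Set.uIcc_of_le hlt.le]; constructor <;> omega))

theorem mem_rightEndpoints {R : Set ℕ} {b : ℕ} :
    b ∈ rightEndpoints R ↔ b ∈ R ∧ b + 1 ∉ R := by
  constructor
  · rintro ⟨I, ⟨⟨hne, hI, hIR⟩, hmax⟩, hbI, hgreat⟩
    refine ⟨hIR hbI, fun h => ?_⟩
    have hJ : (insert (b + 1) I).OrdConnected := by
      refine ⟨fun x hx y hy z hz => ?_⟩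
      rcases eq_or_ne z (b + 1) with rfl | hz'
      · exact Set.mem_insert _ _
      have hyb : y ≤ b + 1 := by
        rcases hy with rfl | hy
        · exact le_rfl
        · exact (hgreat hy).trans (Nat.le_succ _)
      have hbz : z ≤ b := by have := hz.2; omega
      rcases hx with rfl | hx
      · have := hz.1; omega
      · exact Or.inr (hI.out hx hbI ⟨hz.1, hbz⟩)
    have := hmax ⟨⟨b, Or.inr hbI⟩, hJ, Set.insert_subset h hIR⟩ (Set.subset_insert _ _)
      (Set.mem_insert _ _)
    have := hgreat this
    omega
  · rintro ⟨hbR, h⟩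
    refine ⟨_, isMaximalInterval_ordConnectedComponent hbR,
      Set.self_mem_ordConnectedComponent.2 hbR, fun x hx => ?_⟩
    by_contra! hlt
    exact h (hx (by rw [Set.uIcc_of_le hlt.le]; constructor <;> omega))

theorem NoExposedOdds.even_of_mem_leftEndpoints {R : Set ℕ} (h0 : 0 ∉ R) (hR : NoExposedOdds R)
    {a : ℕ} (ha : a ∈ leftEndpoints R) : Even a := by
  obtain ⟨h1, haR, h⟩ := (mem_leftEndpoints h0).1 ha
  by_contra hodd
  rw [Nat.not_even_iff_odd] at hodd
  exact h (hR.2 a haR hodd (by obtain ⟨k, rfl⟩ := hodd; omega)).1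

theorem NoExposedOdds.even_of_mem_rightEndpoints {R : Set ℕ} (hR : NoExposedOdds R)
    {b : ℕ} (hb : b ∈ rightEndpoints R) : Even b := by
  obtain ⟨hbR, h⟩ := mem_rightEndpoints.1 hb
  by_contra hodd
  rw [Nat.not_even_iff_odd] at hodd
  obtain ⟨k, rfl⟩ := hodd
  rcases k with _ | k
  · exact h (hR.1 hbR)
  · exact h (hR.2 _ hbR (by simp) (by omega)).2

theorem two_le_of_mem_leftEndpoints {R : Set ℕ} (h0 : 0 ∉ R)
    {a : ℕ} (ha : a ∈ leftEndpoints R) : 2 ≤ a := by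
  obtain ⟨h1, haR, -⟩ := (mem_leftEndpoints h0).1 ha
  have : a ≠ 0 := fun h => h0 (h ▸ haR)
  omega

theorem NoExposedOdds.two_notMem_leftEndpoints {R : Set ℕ} (h0 : 0 ∉ R) (h1 : 1 ∈ R) :
    2 ∉ leftEndpoints R := fun h => ((mem_leftEndpoints h0).1 h).2.2 h1

theorem NoExposedOdds.two_le_of_mem_rightEndpoints {R : Set ℕ} (h0 : 0 ∉ R)
    (hR : NoExposedOdds R) {b : ℕ} (hb : b ∈ rightEndpoints R) : 2 ≤ b := by
  obtain ⟨c, hc⟩ := hR.even_of_mem_rightEndpoints hb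
  have : b ≠ 0 := fun h => h0 (h ▸ (mem_rightEndpoints.1 hb).1)
  omega

/-! ### Power series supported on a set of exponents -/

/-- The power series `∑ c r X ^ r` over the exponents `r ∈ D`. -/
noncomputable def seriesOn (D : Set ℕ) (c : ℕ → ℚ) : ℚ⟦X⟧ := PowerSeries.mk (D.indicator c)

@[simp] theorem coeff_seriesOn (D : Set ℕ) (c : ℕ → ℚ) (n : ℕ) :
    coeff n (seriesOn D c) = D.indicator c n := coeff_mk _ _

@[simp] theorem constantCoeff_seriesOn (D : Set ℕ) (c : ℕ → ℚ) :
    constantCoeff (seriesOn D c) = D.indicator c 0 := by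
  rw [← coeff_zero_eq_constantCoeff_apply, coeff_seriesOn]

/-- The antiderivative without constant term. -/
noncomputable def antideriv (f : ℚ⟦X⟧) : ℚ⟦X⟧ :=
  PowerSeries.mk fun n => if n = 0 then 0 else coeff (n - 1) f / n

@[simp] theorem constantCoeff_antideriv (f : ℚ⟦X⟧) : constantCoeff (antideriv f) = 0 := by
  rw [← coeff_zero_eq_constantCoeff_apply]; simp [antideriv]

theorem coeff_succ_antideriv (f : ℚ⟦X⟧) (n : ℕ) :
    coeff (n + 1) (antideriv f) = coeff n f / (n + 1) := by
  simp [antideriv]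

@[simp] theorem derivative_antideriv (f : ℚ⟦X⟧) : d⁄dX ℚ (antideriv f) = f := by
  ext n
  rw [coeff_derivative, coeff_succ_antideriv]
  field_simp

theorem hasSubst_neg {E : ℚ⟦X⟧} (hE : constantCoeff E = 0) : HasSubst (-E) :=
  HasSubst.of_constantCoeff_zero' (by simp [hE])

/-- Substituting `-E` is the same as substituting `E` into the series with alternated signs. -/
theorem subst_neg_seriesOn {E : ℚ⟦X⟧} (hE : constantCoeff E = 0) (R : Set ℕ) (c : ℕ → ℚ) :
    (seriesOn R c).subst (-E) = (seriesOn R fun r => (-1) ^ r * c r).subst E := by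
  ext n
  rw [coeff_subst' (hasSubst_neg hE), coeff_subst' (HasSubst.of_constantCoeff_zero' hE)]
  refine finsum_congr fun d => ?_
  rw [neg_pow, ← map_one (C (R := ℚ)), ← map_neg, ← map_pow, coeff_C_mul]
  by_cases hd : d ∈ R <;> simp [hd]
  ring

/-- Uniqueness for a linear differential equation: each coefficient of `h` is determined by the
earlier ones. -/
theorem eq_zero_of_derivative_eq_mul {h g : ℚ⟦X⟧} (h0 : constantCoeff h = 0)
    (hd : d⁄dX ℚ h = h * g) : h = 0 := by
  ext n
  induction n using Nat.strong_induction_on with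
  | _ n ih =>
    rcases n with _ | n
    · simpa using h0
    · have := congrArg (coeff n) hd
      rw [coeff_derivative, coeff_mul, Finset.sum_eq_zero] at this
      · have h2 : ((n : ℚ) + 1) ≠ 0 := by positivity
        simpa [h2] using this
      · intro p hp
        rw [ih p.1 (by have := Finset.HasAntidiagonal.mem_antidiagonal.1 hp; omega)]
        simp

/-! ### Solving the three functional systems -/

section Systems

variable {R : Set ℕ} {E O : ℚ⟦X⟧}

theorem subst_neg_eq_neg_X_of_linear (h0 : 0 ∉ R) (h1 : 1 ∈ R) (hR : NoExposedOdds R)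
    (hE : constantCoeff E = 0)
    (hsE : E = X + O * E + (seriesOn (leftEndpoints R) fun _ => 1).subst E)
    (hsO : O = X + (seriesOn (rightEndpoints R) fun _ => 1).subst E) :
    (seriesOn R fun _ => 1).subst (-E) = -X := by
  rw [subst_neg_seriesOn hE]
  have hs := HasSubst.of_constantCoeff_zero' hE
  set f := seriesOn R fun r => (-1 : ℚ) ^ r * 1 with hf
  -- Coefficient n+1 on the left is (-1)^(n+1) ([n+1 ∈ R] - [n ∈ R]); evenness of the endpoints
  -- makes the surviving terms positive. The term -X comes from 1, which is in `R` but excluded from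
  -- `leftEndpoints R`.
  have key : (1 + X) * f = -X + seriesOn (leftEndpoints R) (fun _ => 1) +
      X * seriesOn (rightEndpoints R) (fun _ => 1) := by
    ext n
    rw [add_mul, one_mul]
    rcases n with _ | n
    · have : 0 ∉ leftEndpoints R := fun h => h0 ((mem_leftEndpoints h0).1 h).2.1
      simp [hf, h0, this]
    · simp only [map_add, coeff_succ_X_mul, map_neg, hf, coeff_seriesOn, coeff_X]
      have ha := mem_leftEndpoints h0 (a := n + 1)
      have hb := mem_rightEndpoints (R := R) (b := n)
      have ha' := hR.even_of_mem_leftEndpoints h0 (a := n + 1)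
      have hb' := hR.even_of_mem_rightEndpoints (b := n)
      rcases eq_or_ne n 0 with rfl | hn
      · simp [h0, h1, ha, hb]
      by_cases hx : n + 1 ∈ R <;> by_cases hy : n ∈ R
      · simp [hx, hy, ha, hb, hn, pow_succ]
      · have := ha' (ha.2 ⟨by simpa using hn, hx, hy⟩)
        simp [hx, hy, ha, hb, hn, this.neg_one_pow]
      · have := hb' (hb.2 ⟨hy, hx⟩)
        simp [hx, hy, ha, hb, hn, this.neg_one_pow]
      · simp [hx, hy, ha, hb, hn]
  have h := congrArg (fun g => g.subst E) key
  simp only [subst_add hs, subst_mul hs, subst_X hs] at h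
  have e1 : (1 : ℚ⟦X⟧).subst E = 1 := by rw [← coe_substAlgHom hs, map_one]
  have e2 : (-X : ℚ⟦X⟧).subst E = -E := by
    rw [← coe_substAlgHom hs, map_neg, coe_substAlgHom hs, subst_X hs]
  rw [e1, e2] at h
  have hne : (1 + E) ≠ 0 := fun h => by
    have := congrArg constantCoeff h
    simp [hE] at this
  apply mul_left_cancel₀ hne
  linear_combination h - hsE - E * hsO

theorem subst_neg_eq_neg_X_of_maxBoxed (h0 : 0 ∉ R) (h1 : 1 ∈ R) (hR : NoExposedOdds R)
    (hE : constantCoeff E = 0)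
    (hsE : E = X + antideriv (O * d⁄dX ℚ E) +
      (seriesOn (leftEndpoints R) fun r => 1 / (r.factorial : ℚ)).subst E)
    (hsO : O = X + (seriesOn (rightEndpoints R) fun r => 1 / (r.factorial : ℚ)).subst E) :
    (seriesOn R fun r => 1 / (r.factorial : ℚ)).subst (-E) = -X := by
  rw [subst_neg_seriesOn hE]
  have hs := HasSubst.of_constantCoeff_zero' hE
  set f := seriesOn R fun r => (-1 : ℚ) ^ r * (1 / (r.factorial : ℚ)) with hf
  set A := seriesOn (leftEndpoints R) fun r => 1 / (r.factorial : ℚ) with hA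
  set B := seriesOn (rightEndpoints R) fun r => 1 / (r.factorial : ℚ) with hB
  -- The same telescoping, where differentiation replaces the shift by `X` because n+1 cancels
  -- against (n+1)!.
  have key : d⁄dX ℚ f + 1 + f = B + d⁄dX ℚ A := by
    ext n
    simp only [map_add, coeff_derivative, hf, hA, hB, coeff_seriesOn, coeff_one]
    have ha := mem_leftEndpoints h0 (a := n + 1)
    have hb := mem_rightEndpoints (R := R) (b := n)
    have ha' := hR.even_of_mem_leftEndpoints h0 (a := n + 1)
    have hb' := hR.even_of_mem_rightEndpoints (b := n)
    rcases eq_or_ne n 0 with rfl | hn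
    · simp [h0, h1, ha, hb]
    have hfac : ((n + 1).factorial : ℚ)⁻¹ * (n + 1) = (n.factorial : ℚ)⁻¹ := by
      rw [Nat.factorial_succ]; push_cast
      have : (n.factorial : ℚ) ≠ 0 := by positivity
      field_simp
    by_cases hx : n + 1 ∈ R <;> by_cases hy : n ∈ R
    · simp [hx, hy, ha, hb, hn, pow_succ, mul_assoc, hfac]
    · have := ha' (ha.2 ⟨by simpa using hn, hx, hy⟩)
      simp [hx, hy, ha, hb, hn, this.neg_one_pow]
    · have := hb' (hb.2 ⟨hy, hx⟩)
      simp [hx, hy, ha, hb, hn, this.neg_one_pow]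
    · simp [hx, hy, ha, hb, hn]
  have h := congrArg (fun g => g.subst E) key
  have e1 : (1 : ℚ⟦X⟧).subst E = 1 := by rw [← coe_substAlgHom hs, map_one]
  simp only [subst_add hs, e1] at h
  have dE := congrArg (d⁄dX ℚ) hsE
  simp only [map_add, derivative_X, derivative_antideriv, derivative_subst hs] at dE
  rw [eq_neg_iff_add_eq_zero]
  -- With h = f(E) + X, the differentiated system collapses to h' = -E' h.
  refine eq_zero_of_derivative_eq_mul (g := -d⁄dX ℚ E) ?_ ?_
  · simp only [map_add, constantCoeff_X, add_zero]
    exact constantCoeff_subst_eq_zero hE _ (by simp [hf, h0])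
  · rw [map_add, derivative_X, derivative_subst hs]
    linear_combination d⁄dX ℚ E * h - dE - d⁄dX ℚ E * hsO

theorem subst_neg_eq_neg_X_of_minBoxed (h0 : 0 ∉ R) (h1 : 1 ∈ R) (hR : NoExposedOdds R)
    (hE : constantCoeff E = 0)
    (hsE : E = X + antideriv (d⁄dX ℚ O * E) +
      (seriesOn (leftEndpoints R) fun r => 1 / (r : ℚ)).subst E)
    (hsO : O = X + (seriesOn (rightEndpoints R) fun r => 1 / (r : ℚ)).subst E) :
    (seriesOn R fun r => 1 / (r : ℚ)).subst (-E) = -X := by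
  rw [subst_neg_seriesOn hE]
  have hs := HasSubst.of_constantCoeff_zero' hE
  set f := seriesOn R fun r => (-1 : ℚ) ^ r * (1 / (r : ℚ)) with hf
  set A := seriesOn (leftEndpoints R) fun r => 1 / (r : ℚ) with hA
  set B := seriesOn (rightEndpoints R) fun r => 1 / (r : ℚ) with hB
  -- The parameter `s` is -1 for `f` and 1 for `A` and `B`.
  have hder (D : Set ℕ) (s : ℚ) (n : ℕ) :
      coeff n (d⁄dX ℚ (seriesOn D fun r => s ^ r * (1 / (r : ℚ)))) =
        D.indicator (fun r => s ^ r) (n + 1) := by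
    rw [coeff_derivative, coeff_seriesOn]
    by_cases hx : n + 1 ∈ D
    · simp only [hx, Set.indicator_of_mem]; push_cast; field_simp
    · simp [hx]
  have hder1 (D : Set ℕ) (n : ℕ) : coeff n (d⁄dX ℚ (seriesOn D fun r => (1 / (r : ℚ)))) =
      D.indicator (fun _ => 1) (n + 1) := by
    simpa using hder D 1 n
  have key : (1 + X) * d⁄dX ℚ f + 1 = d⁄dX ℚ A + X * d⁄dX ℚ B := by
    ext n
    rw [add_mul, one_mul]
    have ha := mem_leftEndpoints h0 (a := n + 1)
    have hb := mem_rightEndpoints (R := R) (b := n)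
    have ha' := hR.even_of_mem_leftEndpoints h0 (a := n + 1)
    have hb' := hR.even_of_mem_rightEndpoints (b := n)
    rcases n with _ | n
    · rw [map_add, map_add, map_add, coeff_zero_X_mul, coeff_zero_X_mul, hf, hA, hder, hder1]
      simp [h1, ha]
    simp only [map_add, coeff_succ_X_mul, hf, hA, hB, hder, hder1, coeff_one]
    by_cases hx : n + 1 + 1 ∈ R <;> by_cases hy : n + 1 ∈ R
    · simp [hx, hy, ha, hb, pow_succ]
    · have := ha' (ha.2 ⟨by simp, hx, hy⟩)
      simp [hx, hy, ha, hb, this.neg_one_pow]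
    · have := hb' (hb.2 ⟨hy, hx⟩)
      simp [hx, hy, ha, hb, this.neg_one_pow]
    · simp [hx, hy, ha, hb]
  have h := congrArg (fun g => g.subst E) key
  have e1 : (1 : ℚ⟦X⟧).subst E = 1 := by rw [← coe_substAlgHom hs, map_one]
  simp only [subst_add hs, subst_mul hs, subst_X hs, e1] at h
  have dE := congrArg (d⁄dX ℚ) hsE
  have dO := congrArg (d⁄dX ℚ) hsO
  simp only [map_add, derivative_X, derivative_antideriv, derivative_subst hs] at dE dO
  rw [eq_neg_iff_add_eq_zero]
  have hne : (1 + E) ≠ 0 := fun h => by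
    have := congrArg constantCoeff h
    simp [hE] at this
  -- Here f(E) + X has zero derivative, once the factor 1 + E is cancelled, and zero constant term.
  apply derivative.ext
  · rw [map_add, derivative_X, derivative_subst hs, map_zero]
    apply mul_left_cancel₀ hne
    linear_combination d⁄dX ℚ E * h - dE - E * dO
  · simp only [map_add, constantCoeff_X, add_zero, map_zero]
    exact constantCoeff_subst_eq_zero hE _ (by simp [hf, h0])

end Systems

end RestrictedStirling

namespace RestrictedStirling

open PowerSeries

/-! ### Exponential generating functions of labeled structures -/

section LabeledStructures

variable {α β γ : Type*}

/-- The structures in the class `P` whose labels are the elements of `S`, each occurring once. -/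
def structuresOn (P : Set α) (s : α → Multiset ℕ) (S : Finset ℕ) : Set α :=
  {a | a ∈ P ∧ s a = S.val}

/-- There are finitely many structures on each finite label set, and their numbers have the
exponential generating function `W`. -/
def HasEGF (P : Set α) (s : α → Multiset ℕ) (W : ℚ⟦X⟧) : Prop :=
  ∀ S : Finset ℕ, (structuresOn P s S).Finite ∧
    ((structuresOn P s S).ncard : ℚ) = S.card.factorial * coeff S.card W

/-- `B` contains a label that dominates all labels in `A`. -/
def Dominates (r : ℕ → ℕ → Prop) (A B : Multiset ℕ) : Prop := ∃ m ∈ B, ∀ l ∈ A, r l m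

/-- Every nonempty finite set of natural numbers has an element that dominates all others. -/
def HasTops (r : ℕ → ℕ → Prop) : Prop :=
  ∀ S : Finset ℕ, S.Nonempty → ∃ m ∈ S, ∀ x ∈ S, x ≠ m → r x m

theorem hasTops_lt : HasTops (· < ·) := fun S hS =>
  ⟨S.max' hS, S.max'_mem hS, fun x hx hne => lt_of_le_of_ne (S.le_max' x hx) hne⟩

theorem hasTops_gt : HasTops (· > ·) := fun S hS =>
  ⟨S.min' hS, S.min'_mem hS, fun x hx hne => lt_of_le_of_ne (S.min'_le x hx) hne.symm⟩

theorem ncard_biUnion_finset {ι : Type*} (t : Finset ι) (f : ι → Set α)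
    (hf : ∀ i ∈ t, (f i).Finite) (hd : (t : Set ι).PairwiseDisjoint f) :
    (⋃ i ∈ t, f i).ncard = ∑ i ∈ t, (f i).ncard := by
  have := t.finite_toSet.ncard_biUnion (s := f) (by simpa using hf) hd
  rw [finsum_mem_coe_finset] at this
  simpa using this

theorem notMem_of_add_eq_val {A B : Multiset ℕ} {S : Finset ℕ} (h : A + B = S.val) (x : ℕ)
    (hA : x ∈ A) : x ∉ B :=
  Multiset.disjoint_left.1 (Multiset.nodup_add.1 (h ▸ S.nodup)).2.2 hA

/-- The two label sets are disjoint, so exactly one of them contains the top label `m`, and only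
that one can dominate. -/
theorem dominates_iff_mem {r : ℕ → ℕ → Prop} [Std.Asymm r] {A B : Multiset ℕ} {S : Finset ℕ}
    (h : A + B = S.val) {m : ℕ} (hm : m ∈ S) (htop : ∀ x ∈ S, x ≠ m → r x m) :
    Dominates r A B ↔ m ∈ B := by
  have hmem (x : ℕ) : x ∈ S ↔ x ∈ A ∨ x ∈ B := by rw [← Finset.mem_val, ← h, Multiset.mem_add]
  have hd := notMem_of_add_eq_val h
  constructor
  · rintro ⟨x, hx, hdom⟩
    by_contra hmB
    have hmA := ((hmem m).1 hm).resolve_right hmB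
    exact Std.Asymm.asymm _ _ (hdom m hmA) (htop x ((hmem x).2 (.inr hx)) fun e => hmB (e ▸ hx))
  · intro hmB
    exact ⟨m, hmB, fun l hl => htop l ((hmem l).2 (.inl hl)) fun e => hd l hl (e ▸ hmB)⟩

theorem HasEGF.congr_bijOn {P : Set α} {s : α → Multiset ℕ} {W : ℚ⟦X⟧} (hP : HasEGF P s W)
    {Q : Set β} {s' : β → Multiset ℕ} (φ : α → β)
    (hφ : ∀ S, Set.BijOn φ (structuresOn P s S) (structuresOn Q s' S)) : HasEGF Q s' W := by
  intro S
  rw [← (hφ S).image_eq, (hφ S).injOn.ncard_image]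
  exact ⟨(hP S).1.image _, (hP S).2⟩

theorem HasEGF.image {P : Set α} {s : α → Multiset ℕ} {W : ℚ⟦X⟧} (hP : HasEGF P s W)
    {Q : Set β} {s' : β → Multiset ℕ} (φ : α → β) (hs : ∀ a ∈ P, s' (φ a) = s a)
    (hinj : Set.InjOn φ P) (hQ : φ '' P = Q) : HasEGF Q s' W := by
  refine hP.congr_bijOn φ fun S => ⟨?_, ?_, ?_⟩
  · rintro a ⟨ha, hS⟩
    exact ⟨hQ ▸ ⟨a, ha, rfl⟩, (hs a ha).trans hS⟩
  · exact hinj.mono fun a ha => ha.1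
  · rintro b ⟨hb, hS⟩
    rw [← hQ] at hb
    obtain ⟨a, ha, rfl⟩ := hb
    exact ⟨a, ⟨ha, (hs a ha).symm.trans hS⟩, rfl⟩

theorem HasEGF.union {P Q : Set α} {s : α → Multiset ℕ} {W V : ℚ⟦X⟧} (hP : HasEGF P s W)
    (hQ : HasEGF Q s V) (hd : Disjoint P Q) : HasEGF (P ∪ Q) s (W + V) := by
  intro S
  have e : structuresOn (P ∪ Q) s S = structuresOn P s S ∪ structuresOn Q s S := by
    ext a; simp only [structuresOn, Set.mem_union, Set.mem_ofPred_eq]; tauto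
  rw [e, Set.ncard_union_eq (hd.mono (fun a h => h.1) (fun a h => h.1)) (hP S).1 (hQ S).1]
  refine ⟨(hP S).1.union (hQ S).1, ?_⟩
  push_cast
  rw [(hP S).2, (hQ S).2, map_add, mul_add]

theorem HasEGF.constantCoeff_eq_zero {P : Set α} {s : α → Multiset ℕ} {W : ℚ⟦X⟧}
    (hP : HasEGF P s W) (h0 : ∀ a ∈ P, s a ≠ 0) : constantCoeff W = 0 := by
  have e : structuresOn P s ∅ = ∅ := by
    ext a; simpa [structuresOn] using h0 a
  have := (hP ∅).2
  rw [e] at this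
  simpa using this.symm

theorem HasEGF.singleton {a : α} {s : α → Multiset ℕ} (ha : s a = 0) : HasEGF {a} s 1 := by
  intro S
  refine ⟨(Set.finite_singleton a).subset fun x hx => hx.1, ?_⟩
  rcases S.eq_empty_or_nonempty with rfl | hS
  · have : structuresOn {a} s ∅ = {a} := by
      ext x
      simp only [structuresOn, Set.mem_singleton_iff, Set.mem_ofPred_eq, Finset.empty_val]
      exact ⟨fun h => h.1, fun h => ⟨h, h ▸ ha⟩⟩
    simp [this]
  · have : structuresOn {a} s S = ∅ := by
      ext x
      simp only [structuresOn, Set.mem_singleton_iff, Set.mem_ofPred_eq, Set.mem_empty_iff_false,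
        iff_false, not_and]
      rintro rfl h
      rw [ha, eq_comm, Finset.val_eq_zero] at h
      exact hS.ne_empty h
    simp [this, coeff_one, hS.ne_empty]

/-- Counting pairs of structures by the label set of the first component. -/
theorem HasEGF.ncard_pairs {P : Set α} {s : α → Multiset ℕ} {W : ℚ⟦X⟧} (hP : HasEGF P s W)
    {Q : Set β} {s' : β → Multiset ℕ} {V : ℚ⟦X⟧} (hQ : HasEGF Q s' V) (S : Finset ℕ)
    (C : Finset (Finset ℕ)) :
    (⋃ T ∈ C, structuresOn P s T ×ˢ structuresOn Q s' (S \ T)).Finite ∧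
      ((⋃ T ∈ C, structuresOn P s T ×ˢ structuresOn Q s' (S \ T)).ncard : ℚ) =
        ∑ T ∈ C, (T.card.factorial * coeff T.card W) *
          ((S \ T).card.factorial * coeff (S \ T).card V) := by
  have hfin (T : Finset ℕ) : (structuresOn P s T ×ˢ structuresOn Q s' (S \ T)).Finite :=
    (hP T).1.prod (hQ _).1
  refine ⟨C.finite_toSet.biUnion fun T _ => hfin T, ?_⟩
  rw [ncard_biUnion_finset _ _ fun T _ => hfin T]
  · push_cast
    exact Finset.sum_congr rfl fun T _ => by
      rw [Set.ncard_prod, Nat.cast_mul, (hP T).2, (hQ _).2]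
  · intro T _ T' _ hne
    refine Set.disjoint_left.2 fun x hx hx' => hne ?_
    exact Finset.val_injective (hx.1.2.symm.trans hx'.1.2)

theorem mem_pairs_iff {P : Set α} {s : α → Multiset ℕ} {Q : Set β} {s' : β → Multiset ℕ}
    {S : Finset ℕ} {C : Finset (Finset ℕ)} {x : α × β} (hC : ∀ T ∈ C, T ⊆ S) :
    x ∈ (⋃ T ∈ C, structuresOn P s T ×ˢ structuresOn Q s' (S \ T)) ↔
      (x.1 ∈ P ∧ x.2 ∈ Q) ∧ s x.1 + s' x.2 = S.val ∧ (s x.1).toFinset ∈ C := by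
  simp only [Set.mem_iUnion, Set.mem_prod, structuresOn, Set.mem_ofPred_eq, exists_prop]
  constructor
  · rintro ⟨T, hT, ⟨h1, h2⟩, h3, h4⟩
    refine ⟨⟨h1, h3⟩, ?_, by simpa [h2] using hT⟩
    rw [h2, h4, Finset.sdiff_val, add_tsub_cancel_of_le (Finset.val_le_iff.2 (hC T hT))]
  · rintro ⟨⟨h1, h3⟩, h, hT⟩
    have hnd : (s x.1).Nodup := (Multiset.nodup_add.1 (h ▸ S.nodup)).1
    have e : (s x.1).toFinset.val = s x.1 := by
      rw [Multiset.toFinset_val, Multiset.dedup_eq_self.2 hnd]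
    refine ⟨_, hT, ⟨h1, e.symm⟩, h3, ?_⟩
    rw [Finset.sdiff_val, e, ← h, add_tsub_cancel_left]

/-- Choosing the label set of the first component yields the binomial convolution. -/
theorem HasEGF.prod {P : Set α} {s : α → Multiset ℕ} {W : ℚ⟦X⟧} (hP : HasEGF P s W)
    {Q : Set β} {s' : β → Multiset ℕ} {V : ℚ⟦X⟧} (hQ : HasEGF Q s' V) :
    HasEGF (P ×ˢ Q) (fun x => s x.1 + s' x.2) (W * V) := by
  intro S
  have e : structuresOn (P ×ˢ Q) (fun x => s x.1 + s' x.2) S =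
      ⋃ T ∈ S.powerset, structuresOn P s T ×ˢ structuresOn Q s' (S \ T) := by
    ext x
    rw [mem_pairs_iff fun T hT => Finset.mem_powerset.1 hT]
    simp only [structuresOn, Set.mem_prod, Set.mem_ofPred_eq, Finset.mem_powerset]
    refine and_congr_right fun _ => ⟨fun h => ⟨h, fun y hy => ?_⟩, fun h => h.1⟩
    rw [← Finset.mem_val, ← h]
    exact Multiset.mem_add.2 (.inl (Multiset.mem_toFinset.1 hy))
  rw [e]
  refine ⟨(hP.ncard_pairs hQ S _).1, (hP.ncard_pairs hQ S _).2.trans ?_⟩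
  set n := S.card with hn
  calc _ = ∑ T ∈ S.powerset, (fun k => (k.factorial * coeff k W) *
          ((n - k).factorial * coeff (n - k) V)) T.card :=
        Finset.sum_congr rfl fun T hT => by
          rw [Finset.card_sdiff_of_subset (Finset.mem_powerset.1 hT)]
    _ = _ := by
        rw [Finset.sum_powerset_apply_card (fun k => k.factorial * coeff k W *
          ((n - k).factorial * coeff (n - k) V)), coeff_mul,
          Finset.Nat.sum_antidiagonal_eq_sum_range_succ
          (fun i j => coeff i W * coeff j V), Finset.mul_sum]
        refine Finset.sum_congr rfl fun k hk => ?_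
        have hk : k ≤ n := Nat.lt_succ_iff.1 (Finset.mem_range.1 hk)
        rw [nsmul_eq_mul, ← hn, ← Nat.choose_mul_factorial_mul_factorial hk]
        push_cast
        ring

/-- The top label is forced into the second component, so the first one takes its labels from the
other n of the n+1 labels. The coefficients are then binomials of n rather than n+1, which is the
effect of differentiating `V` and integrating the product. -/
theorem HasEGF.prod_boxed {r : ℕ → ℕ → Prop} [Std.Asymm r] (hr : HasTops r)
    {P : Set α} {s : α → Multiset ℕ} {W : ℚ⟦X⟧} (hP : HasEGF P s W)
    {Q : Set β} {s' : β → Multiset ℕ} {V : ℚ⟦X⟧} (hQ : HasEGF Q s' V) :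
    HasEGF {x : α × β | (x.1 ∈ P ∧ x.2 ∈ Q) ∧ Dominates r (s x.1) (s' x.2)}
      (fun x => s x.1 + s' x.2) (antideriv (W * d⁄dX ℚ V)) := by
  intro S
  rcases S.eq_empty_or_nonempty with rfl | hS
  · have : structuresOn {x : α × β | (x.1 ∈ P ∧ x.2 ∈ Q) ∧ Dominates r (s x.1) (s' x.2)}
      (fun x => s x.1 + s' x.2) ∅ = ∅ := by
      ext x
      simp only [structuresOn, Set.mem_ofPred_eq, Finset.empty_val, add_eq_zero,
        Set.mem_empty_iff_false, iff_false]
      rintro ⟨⟨-, m, hm, -⟩, -, h0⟩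
      simp [h0] at hm
    simp [this]
  obtain ⟨m, hm, htop⟩ := hr S hS
  have e : structuresOn {x : α × β | (x.1 ∈ P ∧ x.2 ∈ Q) ∧ Dominates r (s x.1) (s' x.2)}
      (fun x => s x.1 + s' x.2) S =
      ⋃ T ∈ (S.erase m).powerset, structuresOn P s T ×ˢ structuresOn Q s' (S \ T) := by
    ext x
    rw [mem_pairs_iff fun T hT => (Finset.mem_powerset.1 hT).trans (S.erase_subset m)]
    simp only [structuresOn, Set.mem_ofPred_eq, Finset.mem_powerset, and_assoc]
    refine and_congr_right fun _ => and_congr_right fun _ => and_comm.trans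
      (and_congr_right fun h => ?_)
    have hmem (x' : ℕ) : x' ∈ S ↔ x' ∈ s x.1 ∨ x' ∈ s' x.2 := by
      rw [← Finset.mem_val, ← h, Multiset.mem_add]
    have hd := notMem_of_add_eq_val h
    rw [dominates_iff_mem h hm htop]
    constructor
    · intro hmB y hy
      rw [Multiset.mem_toFinset] at hy
      exact Finset.mem_erase.2 ⟨fun e => hd y hy (e ▸ hmB), (hmem y).2 (.inl hy)⟩
    · intro hsub
      refine ((hmem m).1 hm).resolve_left fun hmA => ?_
      simpa using hsub (Multiset.mem_toFinset.2 hmA)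
  rw [e]
  refine ⟨(hP.ncard_pairs hQ S _).1, (hP.ncard_pairs hQ S _).2.trans ?_⟩
  obtain ⟨n, hn⟩ : ∃ n, S.card = n + 1 := ⟨S.card - 1, by have := hS.card_pos; omega⟩
  have hn' : (S.erase m).card = n := by rw [Finset.card_erase_of_mem hm, hn]; rfl
  calc _ = ∑ T ∈ (S.erase m).powerset, (fun k => (k.factorial * coeff k W) *
          ((n + 1 - k).factorial * coeff (n + 1 - k) V)) T.card :=
        Finset.sum_congr rfl fun T hT => by
          rw [Finset.card_sdiff_of_subset
            ((Finset.mem_powerset.1 hT).trans (S.erase_subset m)), hn]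
    _ = _ := by
        rw [Finset.sum_powerset_apply_card (fun k => k.factorial * coeff k W *
          ((n + 1 - k).factorial * coeff (n + 1 - k) V)), hn', hn, coeff_succ_antideriv, coeff_mul,
          Finset.Nat.sum_antidiagonal_eq_sum_range_succ
          (fun i j => coeff i W * coeff j (d⁄dX ℚ V)), Nat.factorial_succ, Nat.cast_mul,
          mul_comm ((n + 1 : ℕ) : ℚ), Nat.cast_add_one, mul_assoc,
          mul_div_cancel₀ _ (by positivity),
          Finset.mul_sum]
        refine Finset.sum_congr rfl fun k hk => ?_
        have hk : k ≤ n := Nat.lt_succ_iff.1 (Finset.mem_range.1 hk)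
        rw [nsmul_eq_mul, ← Nat.choose_mul_factorial_mul_factorial hk, Nat.succ_sub hk,
          Nat.factorial_succ, coeff_derivative]
        push_cast
        ring

/-- Substitution into a generating function supported on `D`. -/
theorem HasEGF.iUnion_subst {D : Set ℕ} {c : ℕ → ℚ} {W : ℚ⟦X⟧} (hW : constantCoeff W = 0)
    {Q : ℕ → Set α} {s : α → Multiset ℕ} (hQ : ∀ d ∈ D, HasEGF (Q d) s (c d • W ^ d))
    (hd : Pairwise fun i j => Disjoint (Q i) (Q j)) :
    HasEGF (⋃ d ∈ D, Q d) s ((seriesOn D c).subst W) := by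
  classical
  intro S
  set n := S.card with hn
  have hcoeff (d : ℕ) (h : n < d) : coeff n (W ^ d) = 0 := by
    apply coeff_of_lt_order
    refine lt_of_lt_of_le (by exact_mod_cast h) (le_order_pow_of_constantCoeff_eq_zero d hW)
  have e : structuresOn (⋃ d ∈ D, Q d) s S =
      ⋃ d ∈ (Finset.range (n + 1)).filter (· ∈ D), structuresOn (Q d) s S := by
    ext a
    simp only [structuresOn, Set.mem_iUnion, Set.mem_ofPred_eq, Finset.mem_filter,
      Finset.mem_range, exists_prop]
    constructor
    · rintro ⟨⟨d, hdD, ha⟩, hS⟩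
      refine ⟨d, ⟨?_, hdD⟩, ha, hS⟩
      -- A series without constant term has no terms of `W ^ d` below degree d, so classes with d >
      -- n contribute no structure on n labels.
      by_contra! hlt
      obtain ⟨hfin, hcard⟩ := hQ d hdD S
      rw [map_smul, hcoeff d (by omega), smul_zero, mul_zero, Nat.cast_eq_zero,
        Set.ncard_eq_zero hfin] at hcard
      exact (Set.ext_iff.1 hcard a).1 ⟨ha, hS⟩
    · rintro ⟨d, ⟨-, hdD⟩, ha, hS⟩
      exact ⟨⟨d, hdD, ha⟩, hS⟩
  have hfin : ∀ d ∈ (Finset.range (n + 1)).filter (· ∈ D), (structuresOn (Q d) s S).Finite :=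
    fun d hdD => (hQ d (Finset.mem_filter.1 hdD).2 S).1
  rw [e]
  refine ⟨(Finset.finite_toSet _).biUnion hfin, ?_⟩
  rw [ncard_biUnion_finset _ _ hfin]
  · rw [coeff_subst' (HasSubst.of_constantCoeff_zero' hW), finsum_eq_sum_of_support_subset
      (s := (Finset.range (n + 1)).filter (· ∈ D)), Finset.mul_sum, Nat.cast_sum]
    · refine Finset.sum_congr rfl fun d hdD => ?_
      have hdD := (Finset.mem_filter.1 hdD).2
      rw [(hQ d hdD S).2, coeff_seriesOn, Set.indicator_of_mem hdD, map_smul]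
    · intro d hdS
      rw [Function.mem_support] at hdS
      simp only [Finset.coe_filter, Finset.mem_range, Set.mem_ofPred_eq]
      constructor
      · by_contra! hlt
        exact hdS (by rw [hcoeff d (by omega), smul_zero])
      · by_contra hD
        exact hdS (by simp [hD])
  · intro i _ j _ hij
    exact (hd hij).mono (fun a h => h.1) (fun a h => h.1)

/-- This computes the effect of boxing in one more component; iterating it turns 1/d! into 1/(d+1)!.
-/
theorem antideriv_smul_pow_mul_derivative {W : ℚ⟦X⟧} (hW : constantCoeff W = 0) (c : ℚ) (d : ℕ) :
    antideriv ((c • W ^ d) * d⁄dX ℚ W) = (c / (d + 1)) • W ^ (d + 1) := by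
  apply derivative.ext
  · rw [derivative_antideriv, Derivation.map_smul, derivative_pow]
    simp only [smul_eq_C_mul, Nat.add_sub_cancel]
    have : C (R := ℚ) (c / (d + 1)) * ((d + 1 : ℕ) : ℚ⟦X⟧) = C c := by
      rw [← map_natCast (C (R := ℚ)), ← map_mul]
      congr 1
      push_cast
      field_simp
    rw [← this]
    ring
  · simp [hW]

/-! ### Lists and finite sets of structures -/

/-- The labels of the members of a list of structures. -/
def listLabels (s : α → Multiset ℕ) (cs : List α) : Multiset ℕ := (cs.map s).sum

@[simp] theorem listLabels_nil (s : α → Multiset ℕ) : listLabels s [] = 0 := rfl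

@[simp] theorem listLabels_cons (s : α → Multiset ℕ) (c : α) (cs : List α) :
    listLabels s (c :: cs) = s c + listLabels s cs := by simp [listLabels]

@[simp] theorem listLabels_append (s : α → Multiset ℕ) (cs cs' : List α) :
    listLabels s (cs ++ cs') = listLabels s cs + listLabels s cs' := by simp [listLabels]

theorem mem_listLabels {s : α → Multiset ℕ} {cs : List α} {l : ℕ} :
    l ∈ listLabels s cs ↔ ∃ c ∈ cs, l ∈ s c := by
  induction cs with
  | nil => simp
  | cons c cs ih => simp [ih]

/-- The top element of `B` can replace all the individual witnesses. Nonemptiness of `B` is needed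
when the family is empty. -/
theorem dominates_iff_forall {r : ℕ → ℕ → Prop} [IsTrans ℕ r] (hr : HasTops r) {ι : Type*}
    {I : ι → Prop} {A : ι → Multiset ℕ} {B U : Multiset ℕ} (hU : ∀ l, l ∈ U ↔ ∃ i, I i ∧ l ∈ A i)
    (hB : B ≠ 0) : Dominates r U B ↔ ∀ i, I i → Dominates r (A i) B := by
  constructor
  · rintro ⟨m, hm, h⟩ i hi
    exact ⟨m, hm, fun l hl => h l ((hU l).2 ⟨i, hi, hl⟩)⟩
  · intro h
    obtain ⟨m, hm, htop⟩ := hr B.toFinset (by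
      obtain ⟨x, hx⟩ := Multiset.exists_mem_of_ne_zero hB
      exact ⟨x, Multiset.mem_toFinset.2 hx⟩)
    refine ⟨m, Multiset.mem_toFinset.1 hm, fun l hl => ?_⟩
    obtain ⟨i, hi, hl⟩ := (hU l).1 hl
    obtain ⟨m', hm', h'⟩ := h i hi
    rcases eq_or_ne m' m with rfl | hne
    · exact h' l hl
    · exact _root_.trans (h' l hl) (htop m' (Multiset.mem_toFinset.2 hm') hne)

theorem dominates_listLabels {r : ℕ → ℕ → Prop} [IsTrans ℕ r] (hr : HasTops r)
    {s : α → Multiset ℕ} {cs : List α} {B : Multiset ℕ} (hB : B ≠ 0) :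
    Dominates r (listLabels s cs) B ↔ ∀ c ∈ cs, Dominates r (s c) B :=
  dominates_iff_forall hr (fun _ => mem_listLabels) hB

variable {P : Set α} {s : α → Multiset ℕ} {W : ℚ⟦X⟧}

theorem HasEGF.lists (hP : HasEGF P s W) (d : ℕ) :
    HasEGF {cs : List α | cs.length = d ∧ ∀ c ∈ cs, c ∈ P} (listLabels s) (W ^ d) := by
  induction d with
  | zero =>
    have : {cs : List α | cs.length = 0 ∧ ∀ c ∈ cs, c ∈ P} = {[]} := by
      ext cs
      simp only [List.length_eq_zero_iff, Set.mem_ofPred_eq, Set.mem_singleton_iff]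
      exact ⟨fun h => h.1, by rintro rfl; simp⟩
    rw [this, pow_zero]
    exact HasEGF.singleton rfl
  | succ d ih =>
    rw [pow_succ']
    refine (hP.prod ih).image (fun x => x.1 :: x.2) (fun x _ => by simp) ?_ ?_
    · rintro ⟨a, b⟩ - ⟨a', b'⟩ - h
      simpa using h
    · ext cs
      constructor
      · rintro ⟨⟨c, cs⟩, ⟨hc, hl, hcs⟩, rfl⟩
        refine ⟨by simpa using hl, ?_⟩
        rintro x (_ | ⟨_, hx⟩)
        exacts [hc, hcs x hx]
      · rintro ⟨hl, hcs⟩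
        rcases cs with _ | ⟨c, cs⟩
        · simp at hl
        · exact ⟨(c, cs), ⟨hcs c (by simp), by simpa using hl, fun x hx => hcs x (by simp [hx])⟩,
            rfl⟩

/-- The head is the boxed component over an arbitrary list of length d, and ∫ W^d W' =
W^(d+1)/(d+1). -/
theorem HasEGF.lists_head_dominates {r : ℕ → ℕ → Prop} [Std.Asymm r] [IsTrans ℕ r] (hr : HasTops r)
    (hP : HasEGF P s W) (h0 : ∀ a ∈ P, s a ≠ 0) (d : ℕ) :
    HasEGF {cs : List α | cs.length = d + 1 ∧ (∀ c ∈ cs, c ∈ P) ∧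
      ∀ c cs', cs = c :: cs' → ∀ b ∈ cs', Dominates r (s b) (s c)} (listLabels s)
      ((1 / ((d + 1 : ℕ) : ℚ)) • W ^ (d + 1)) := by
  have h := antideriv_smul_pow_mul_derivative (hP.constantCoeff_eq_zero h0) 1 d
  rw [one_smul] at h
  rw [Nat.cast_add_one, ← h]
  refine ((hP.lists d).prod_boxed hr hP).image (fun x => x.2 :: x.1)
    (fun x _ => by simp [add_comm]) ?_ ?_
  · rintro ⟨a, b⟩ - ⟨a', b'⟩ - h
    simpa [and_comm] using h
  · ext cs
    constructor
    · rintro ⟨⟨cs, c⟩, ⟨⟨⟨hl, hcs⟩, hc⟩, hdom⟩, rfl⟩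
      refine ⟨by simpa using hl, ?_, ?_⟩
      · rintro x (_ | ⟨_, hx⟩)
        exacts [hc, hcs x hx]
      · rintro c' cs' h
        obtain ⟨rfl, rfl⟩ := List.cons.inj h
        exact (dominates_listLabels hr (h0 _ hc)).1 hdom
    · rintro ⟨hl, hcs, hdom⟩
      rcases cs with _ | ⟨c, cs⟩
      · simp at hl
      · exact ⟨(cs, c), ⟨⟨⟨by simpa using hl, fun x hx => hcs x (by simp [hx])⟩,
          hcs c (by simp)⟩, (dominates_listLabels hr (h0 c (hcs c (by simp)))).2 (hdom c cs rfl)⟩,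
          rfl⟩

/-- By transitivity the last entry dominates the union of the others, so lists grow at the right end
by boxed products. -/
theorem HasEGF.lists_pairwise_dominates {r : ℕ → ℕ → Prop} [Std.Asymm r] [IsTrans ℕ r]
    (hr : HasTops r) (hP : HasEGF P s W) (h0 : ∀ a ∈ P, s a ≠ 0) (d : ℕ) :
    HasEGF {cs : List α | cs.length = d ∧ (∀ c ∈ cs, c ∈ P) ∧
      cs.Pairwise fun a b => Dominates r (s a) (s b)} (listLabels s)
      ((1 / (d.factorial : ℚ)) • W ^ d) := by
  induction d with
  | zero =>
    have : {cs : List α | cs.length = 0 ∧ (∀ c ∈ cs, c ∈ P) ∧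
        cs.Pairwise fun a b => Dominates r (s a) (s b)} = {[]} := by
      ext cs
      simp only [List.length_eq_zero_iff, Set.mem_ofPred_eq, Set.mem_singleton_iff]
      exact ⟨fun h => h.1, by rintro rfl; simp⟩
    rw [this]
    simpa using HasEGF.singleton (listLabels_nil s)
  | succ d ih =>
    have h := antideriv_smul_pow_mul_derivative (hP.constantCoeff_eq_zero h0)
      (1 / (d.factorial : ℚ)) d
    have e : (1 / (d.factorial : ℚ)) / (d + 1) = 1 / ((d + 1).factorial : ℚ) := by
      rw [Nat.factorial_succ]; push_cast; field_simp
    rw [← e, ← h]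
    refine (ih.prod_boxed hr hP).image (fun x => x.1 ++ [x.2]) (fun x _ => by simp) ?_ ?_
    · rintro ⟨a, b⟩ - ⟨a', b'⟩ - h
      simpa using h
    · ext cs
      constructor
      · rintro ⟨⟨cs, c⟩, ⟨⟨⟨hl, hcs, hpw⟩, hc⟩, hdom⟩, rfl⟩
        refine ⟨by simpa using hl, ?_, ?_⟩
        · intro x hx
          rcases List.mem_append.1 hx with hx | hx
          · exact hcs x hx
          · rw [List.mem_singleton.1 hx]; exact hc
        · rw [List.pairwise_append]
          refine ⟨hpw, List.pairwise_singleton _ _, fun a ha b hb => ?_⟩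
          rw [List.mem_singleton.1 hb]
          exact (dominates_listLabels hr (h0 _ hc)).1 hdom a ha
      · rintro ⟨hl, hcs, hpw⟩
        rcases List.eq_nil_or_concat' cs with rfl | ⟨cs, c, rfl⟩
        · simp at hl
        · rw [List.pairwise_append] at hpw
          have hc := hcs c (by simp)
          exact ⟨(cs, c), ⟨⟨⟨by simpa using hl, fun x hx => hcs x (by simp [hx]), hpw.1⟩, hc⟩,
            (dominates_listLabels hr (h0 c hc)).2 fun a ha => hpw.2.2 a ha c (by simp)⟩, rfl⟩

/-- In a set of d+1 structures exactly one holds the largest label; removing it leaves an arbitrary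
set of d structures. Nonempty label sets keep the members distinct. -/
theorem HasEGF.finsets (hP : HasEGF P s W) (h0 : ∀ a ∈ P, s a ≠ 0) (d : ℕ) :
    HasEGF {C : Finset α | C.card = d ∧ ∀ c ∈ C, c ∈ P} (fun C => ∑ c ∈ C, s c)
      ((1 / (d.factorial : ℚ)) • W ^ d) := by
  classical
  induction d with
  | zero =>
    have : {C : Finset α | C.card = 0 ∧ ∀ c ∈ C, c ∈ P} = {∅} := by
      ext C
      simp only [Finset.card_eq_zero, Set.mem_ofPred_eq, Set.mem_singleton_iff]
      exact ⟨fun h => h.1, by rintro rfl; simp⟩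
    rw [this]
    simpa using HasEGF.singleton (a := (∅ : Finset α)) (s := fun C => ∑ c ∈ C, s c) (by simp)
  | succ d ih =>
    have h := antideriv_smul_pow_mul_derivative (hP.constantCoeff_eq_zero h0)
      (1 / (d.factorial : ℚ)) d
    have e : (1 / (d.factorial : ℚ)) / (d + 1) = 1 / ((d + 1).factorial : ℚ) := by
      rw [Nat.factorial_succ]; push_cast; field_simp
    rw [← e, ← h]
    have hmem {C : Finset α} {l : ℕ} : l ∈ ∑ c ∈ C, s c ↔ ∃ c ∈ C, l ∈ s c := Multiset.mem_sum
    have hnot {C : Finset α} {c : α} {S : Finset ℕ} (hc : c ∈ P)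
        (hS : ∑ c ∈ C, s c + s c = S.val) : c ∉ C := fun hcC => by
      obtain ⟨x, hx⟩ := Multiset.exists_mem_of_ne_zero (h0 c hc)
      exact notMem_of_add_eq_val hS _ (hmem.2 ⟨c, hcC, hx⟩) hx
    -- Insertion is shown to be bijective only for each fixed label set: it relies on labels not
    -- being repeated.
    refine (ih.prod_boxed hasTops_lt hP).congr_bijOn (fun x => insert x.2 x.1)
      fun S => ⟨?_, ?_, ?_⟩
    · rintro ⟨C, c⟩ ⟨⟨⟨⟨hl, hC⟩, hc⟩, hdom⟩, hS⟩
      have hcC := hnot hc hS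
      refine ⟨⟨by rw [Finset.card_insert_of_notMem hcC]; exact congrArg (· + 1) hl, ?_⟩, ?_⟩
      · intro x hx
        rcases Finset.mem_insert.1 hx with rfl | hx
        exacts [hc, hC x hx]
      · change ∑ x ∈ insert c C, s x = _
        rw [Finset.sum_insert hcC, add_comm]
        exact hS
    · rintro ⟨C, c⟩ ⟨⟨⟨⟨hl, hC⟩, hc⟩, hdom⟩, hS⟩ ⟨C', c'⟩ ⟨⟨⟨⟨hl', hC'⟩, hc'⟩, hdom'⟩, hS'⟩ heq
      dsimp only at *
      have hcC := hnot hc hS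
      have hcC' := hnot hc' hS'
      have hne : S.Nonempty := by
        obtain ⟨x, hx⟩ := Multiset.exists_mem_of_ne_zero (h0 c hc)
        exact ⟨x, by rw [← Finset.mem_val, ← hS]; exact Multiset.mem_add.2 (.inr hx)⟩
      obtain ⟨m, hm, htop⟩ := hasTops_lt S hne
      rw [dominates_iff_mem hS hm htop] at hdom
      rw [dominates_iff_mem hS' hm htop] at hdom'
      have : c = c' := by
        by_contra hcc
        have : c' ∈ insert c C := heq ▸ Finset.mem_insert_self c' C'
        have : c' ∈ C := (Finset.mem_insert.1 this).resolve_left (Ne.symm hcc)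
        exact notMem_of_add_eq_val hS _ (hmem.2 ⟨c', this, hdom'⟩) hdom
      subst this
      rw [← Finset.erase_insert hcC, heq, Finset.erase_insert hcC']
    · rintro C ⟨⟨hl, hC⟩, hS⟩
      dsimp only at hS
      have hne : S.Nonempty := by
        obtain ⟨c, hc⟩ : C.Nonempty := Finset.card_pos.1 (by omega)
        obtain ⟨x, hx⟩ := Multiset.exists_mem_of_ne_zero (h0 c (hC c hc))
        exact ⟨x, by rw [← Finset.mem_val, ← hS]; exact hmem.2 ⟨c, hc, hx⟩⟩
      obtain ⟨m, hm, htop⟩ := hasTops_lt S hne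
      obtain ⟨c, hc, hmc⟩ := hmem.1 (show m ∈ ∑ c ∈ C, s c by rwa [hS, Finset.mem_val])
      have hS' : ∑ c ∈ C.erase c, s c + s c = S.val := by rw [Finset.sum_erase_add _ _ hc, hS]
      exact ⟨(C.erase c, c), ⟨⟨⟨⟨by rw [Finset.card_erase_of_mem hc]; omega,
        fun x hx => hC x (Finset.mem_of_mem_erase hx)⟩, hC c hc⟩,
        (dominates_iff_mem hS' hm htop).2 hmc⟩, hS'⟩, Finset.insert_erase hc⟩

end LabeledStructures

end RestrictedStirling

namespace RestrictedStirling

open PowerSeries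

namespace OTree

/-! ### Vertices of trees and the parity of chains of binary vertices -/

theorem induction_children {M : OTree → Prop} (leaf : ∀ l, M (leaf l))
    (node : ∀ cs, (∀ c ∈ cs, M c) → M (node cs)) : ∀ t, M t
  | .leaf l => leaf l
  | .node cs => node cs fun c hc =>
    have : sizeOf c < sizeOf (OTree.node cs) := by
      have := List.sizeOf_lt_of_mem hc
      simp only [OTree.node.sizeOf_spec]
      omega
    induction_children leaf node c
termination_by t => sizeOf t

theorem subtreeAt_cons (t : OTree) (i : ℕ) (p : List ℕ) :
    t.subtreeAt (i :: p) = (t.subtreeAt [i]).bind fun c => c.subtreeAt p := by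
  cases t with
  | leaf l => simp [subtreeAt]
  | node cs => cases h : cs[i]? <;> simp [subtreeAt, h]

@[simp] theorem subtreeAt_nil (t : OTree) : t.subtreeAt [] = some t := by
  cases t <;> simp [subtreeAt]

theorem subtreeAt_node_singleton (cs : List OTree) (i : ℕ) :
    (node cs).subtreeAt [i] = cs[i]? := by
  cases h : cs[i]? <;> simp [subtreeAt, h]

theorem subtreeAt_leaf {l : ℕ} {p : List ℕ} {s : OTree} :
    (leaf l).subtreeAt p = some s ↔ p = [] ∧ s = leaf l := by
  cases p <;> simp [subtreeAt, eq_comm]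

theorem subtreeAt_node_cons {cs : List OTree} {i : ℕ} {p : List ℕ} {s : OTree} :
    (node cs).subtreeAt (i :: p) = some s ↔ ∃ c, cs[i]? = some c ∧ c.subtreeAt p = some s := by
  rw [subtreeAt_cons, subtreeAt_node_singleton, Option.bind_eq_some_iff]

theorem exists_child_of_degree_eq_two {t : OTree} (h : t.degree = 2) :
    ∃ c, t.subtreeAt [0] = some c := by
  cases t with
  | leaf l => simp [degree] at h
  | node cs =>
    rw [degree] at h
    rw [subtreeAt_node_singleton]
    exact ⟨cs[0], List.getElem?_eq_getElem (by omega)⟩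

/-- The vertex `p` of `t` ends an odd chain of left-most children of binary vertices, where `b`
tells whether this is so for the root of `t`. -/
def OddAt : List ℕ → Prop → OTree → Prop
  | [], b, _ => b
  | i :: p, b, t => ∃ c, t.subtreeAt [i] = some c ∧ OddAt p (i = 0 ∧ t.degree = 2 ∧ ¬ b) c

/-- `OddAt` recurses from the root downwards; this unfolds it at the last step instead, matching
`hasTwoLeftOddAncestry_concat`. -/
theorem oddAt_concat (p : List ℕ) (j : ℕ) (b : Prop) (t : OTree) :
    OddAt (p ++ [j]) b t ↔ j = 0 ∧ t.HasDegreeAt p 2 ∧ ¬ OddAt p b t := by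
  induction p generalizing b t with
  | nil =>
    simp only [List.nil_append, OddAt, HasDegreeAt, subtreeAt_nil, Option.some.injEq,
      exists_eq_left']
    constructor
    · rintro ⟨c, -, h⟩
      exact h
    · rintro ⟨rfl, h, hb⟩
      obtain ⟨c, hc⟩ := exists_child_of_degree_eq_two h
      exact ⟨c, hc, rfl, h, hb⟩
  | cons i p ih =>
    simp only [List.cons_append, OddAt, ih, HasDegreeAt]
    rw [subtreeAt_cons t i p]
    rcases t.subtreeAt [i] with _ | c <;> simp

/-- Follow the chain upwards from `p` as long as each step is a left-most step below a binary
vertex. -/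
theorem exists_chain (t : OTree) (p : List ℕ) : ∃ (q : List ℕ) (m : ℕ),
    p = q ++ List.replicate m 0 ∧ (∀ i < m, t.HasDegreeAt (q ++ List.replicate i 0) 2) ∧
      ¬ ∃ w : List ℕ, q = w ++ [0] ∧ t.HasDegreeAt w 2 := by
  induction p using List.reverseRecOn with
  | nil => exact ⟨[], 0, by simp⟩
  | append_singleton p j ih =>
    by_cases h : j = 0 ∧ t.HasDegreeAt p 2
    · obtain ⟨rfl, h⟩ := h
      obtain ⟨q, m, rfl, hm, hq⟩ := ih
      refine ⟨q, m + 1, by simp [List.replicate_succ'], fun i hi => ?_, hq⟩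
      rcases Nat.lt_succ_iff_lt_or_eq.1 hi with hi | rfl
      exacts [hm i hi, h]
    · refine ⟨p ++ [j], 0, by simp, by simp, ?_⟩
      rintro ⟨w, hw, hd⟩
      obtain ⟨rfl, hj⟩ := List.append_inj' hw rfl
      exact h ⟨by simpa using hj, hd⟩

/-- A longer chain would pass through `q'` and continue above it. Used in both directions, this
makes the length, hence its parity, well defined. -/
theorem chain_start_unique {t : OTree} {q q' : List ℕ} {m m' : ℕ}
    (h : q ++ List.replicate m 0 = q' ++ List.replicate m' 0)
    (hm : ∀ i < m, t.HasDegreeAt (q ++ List.replicate i 0) 2)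
    (hq' : ¬ ∃ w : List ℕ, q' = w ++ [0] ∧ t.HasDegreeAt w 2) : m ≤ m' := by
  by_contra! hlt
  apply hq'
  obtain ⟨k, rfl⟩ : ∃ k, m = k + 1 + m' := ⟨m - m' - 1, by omega⟩
  rw [List.replicate_add, ← List.append_assoc] at h
  refine ⟨q ++ List.replicate k 0, ?_, hm k (by omega)⟩
  rw [← (List.append_inj' h (by simp)).1, List.replicate_succ', List.append_assoc]

theorem hasTwoLeftOddAncestry_concat (t : OTree) (p : List ℕ) (j : ℕ) :
    t.HasTwoLeftOddAncestry (p ++ [j]) ↔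
      j = 0 ∧ t.HasDegreeAt p 2 ∧ ¬ t.HasTwoLeftOddAncestry p := by
  constructor
  · rintro ⟨q, m, ⟨k, rfl⟩, hp, hm, hq⟩
    rw [List.replicate_succ', ← List.append_assoc] at hp
    obtain ⟨rfl, hj⟩ := List.append_inj' hp rfl
    refine ⟨by simpa using hj, hm _ (by omega), ?_⟩
    rintro ⟨q', m', hm'odd, hp', hm', hq'⟩
    have h1 := chain_start_unique hp' (fun i hi => hm i (by omega)) hq'
    have h2 := chain_start_unique hp'.symm hm' hq
    have : m' = 2 * k := le_antisymm h2 h1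
    rw [this] at hm'odd
    exact Nat.not_odd_iff_even.2 (even_two_mul k) hm'odd
  · rintro ⟨rfl, hd, hno⟩
    obtain ⟨q, m, rfl, hm, hq⟩ := exists_chain t p
    have hmeven : Even m := by
      by_contra hodd
      exact hno ⟨q, m, Nat.not_even_iff_odd.1 hodd, rfl, hm, hq⟩
    refine ⟨q, m + 1, hmeven.add_one, by simp [List.replicate_succ'], fun i hi => ?_, hq⟩
    rcases Nat.lt_succ_iff_lt_or_eq.1 hi with hi | rfl
    exacts [hm i hi, hd]

theorem hasTwoLeftOddAncestry_iff (t : OTree) (p : List ℕ) :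
    t.HasTwoLeftOddAncestry p ↔ OddAt p False t := by
  induction p using List.reverseRecOn with
  | nil =>
    simp only [OddAt, iff_false]
    rintro ⟨q, m, ⟨k, rfl⟩, hp, -⟩
    simp [List.replicate_succ] at hp
  | append_singleton p j ih => rw [hasTwoLeftOddAncestry_concat, oddAt_concat, ih]

/-! ### Decomposition of good trees at the root -/

/-- `Q` holds for the list of children of every non-leaf vertex. -/
def Everywhere (Q : List OTree → Prop) (t : OTree) : Prop :=
  ∀ p cs, t.subtreeAt p = some (node cs) → Q cs

theorem everywhere_leaf (Q : List OTree → Prop) (l : ℕ) : (leaf l).Everywhere Q := by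
  rintro p cs h
  simp [subtreeAt_leaf] at h

theorem everywhere_node {Q : List OTree → Prop} {cs : List OTree} :
    (node cs).Everywhere Q ↔ Q cs ∧ ∀ c ∈ cs, c.Everywhere Q := by
  constructor
  · refine fun h => ⟨h [] cs (subtreeAt_nil _), fun c hc p ds hp => ?_⟩
    obtain ⟨i, hi⟩ := List.mem_iff_getElem?.1 hc
    exact h (i :: p) ds (subtreeAt_node_cons.2 ⟨c, hi, hp⟩)
  · rintro ⟨h, hcs⟩ p ds hp
    rcases p with _ | ⟨i, p⟩
    · cases (subtreeAt_nil _).symm.trans hp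
      exact h
    · obtain ⟨c, hi, hp⟩ := subtreeAt_node_cons.1 hp
      exact hcs c (List.mem_of_getElem? hi) p ds hp

/-- The tree is `R`-good, where `b` tells whether its root has `2`-left-odd ancestry. -/
def GoodFrom (R : Set ℕ) (b : Prop) (t : OTree) : Prop :=
  ∀ p s, t.subtreeAt p = some s →
    (¬ OddAt p b t → s.degree = 0 ∨ s.degree = 2 ∨ s.degree ∈ leftEndpoints R) ∧
    (OddAt p b t → s.degree = 0 ∨ s.degree ∈ rightEndpoints R)

theorem isGood_iff {R : Set ℕ} {t : OTree} : t.IsGood R ↔ t.GoodFrom R False := by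
  simp only [IsGood, GoodFrom, hasTwoLeftOddAncestry_iff]

theorem goodFrom_leaf (R : Set ℕ) (b : Prop) (l : ℕ) : (leaf l).GoodFrom R b := by
  rintro p s h
  obtain ⟨-, rfl⟩ := subtreeAt_leaf.1 h
  simp [degree]

theorem goodFrom_node {R : Set ℕ} {b : Prop} {cs : List OTree} :
    (node cs).GoodFrom R b ↔
      ((¬ b → cs.length = 0 ∨ cs.length = 2 ∨ cs.length ∈ leftEndpoints R) ∧
        (b → cs.length = 0 ∨ cs.length ∈ rightEndpoints R)) ∧
      ∀ (i : ℕ) (c : OTree), cs[i]? = some c → c.GoodFrom R (i = 0 ∧ cs.length = 2 ∧ ¬ b) := by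
  have hodd {i : ℕ} {c : OTree} (hi : cs[i]? = some c) (p : List ℕ) :
      OddAt (i :: p) b (node cs) ↔ OddAt p (i = 0 ∧ cs.length = 2 ∧ ¬ b) c := by
    simp [OddAt, subtreeAt_node_singleton, hi, degree]
  constructor
  · refine fun h => ⟨h [] _ (subtreeAt_nil _), fun i c hi p s hp => ?_⟩
    rw [← hodd hi]
    exact h (i :: p) s (subtreeAt_node_cons.2 ⟨c, hi, hp⟩)
  · rintro ⟨h, hcs⟩ p s hp
    rcases p with _ | ⟨i, p⟩
    · cases (subtreeAt_nil _).symm.trans hp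
      exact h
    · obtain ⟨c, hi, hp⟩ := subtreeAt_node_cons.1 hp
      rw [hodd hi]
      exact hcs i c hi p s hp

/-- The labels of the leaves. -/
def labels (t : OTree) : Multiset ℕ := t.leaves

@[simp] theorem labels_leaf (l : ℕ) : (leaf l).labels = {l} := by simp [labels, leaves]

@[simp] theorem labels_node (cs : List OTree) : (node cs).labels = listLabels labels cs := by
  induction cs with
  | nil => simp [labels, leaves]
  | cons c cs ih =>
    rw [listLabels_cons, ← ih]
    simp [labels, leaves]

end OTree

/-! ### Recursive equations for the classes of good trees -/

open OTree

/-- The `R`-good phylogenetic trees in which all complete lists of siblings satisfy `ord`; here `b`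
tells whether the root counts as a vertex with `2`-left-odd ancestry. -/
def goodTrees (R : Set ℕ) (ord : List OTree → Prop) (b : Prop) : Set OTree :=
  {t | t.IsPhylogenetic ∧ t.GoodFrom R b ∧ t.Everywhere ord}

section Decomposition

variable {R : Set ℕ} {ord : List OTree → Prop}

theorem isPhylogenetic_node {cs : List OTree} :
    (node cs).IsPhylogenetic ↔ 2 ≤ cs.length ∧ ∀ c ∈ cs, c.IsPhylogenetic := by
  have : cs ≠ [] ∧ cs.length ≠ 1 ↔ 2 ≤ cs.length := by
    rw [← List.length_pos_iff]; omega
  rw [← this]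
  exact everywhere_node (Q := fun cs => cs ≠ [] ∧ cs.length ≠ 1)

theorem leaf_mem_goodTrees (b : Prop) (l : ℕ) : leaf l ∈ goodTrees R ord b :=
  ⟨everywhere_leaf _ l, goodFrom_leaf _ _ _, everywhere_leaf _ _⟩

theorem node_mem_goodTrees {b : Prop} {cs : List OTree} :
    node cs ∈ goodTrees R ord b ↔ 2 ≤ cs.length ∧
      ((¬ b → cs.length = 2 ∨ cs.length ∈ leftEndpoints R) ∧
        (b → cs.length ∈ rightEndpoints R)) ∧ ord cs ∧
      ∀ (i : ℕ) (c : OTree), cs[i]? = some c →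
        c ∈ goodTrees R ord (i = 0 ∧ cs.length = 2 ∧ ¬ b) := by
  have hforall {Q : OTree → Prop} : (∀ c ∈ cs, Q c) ↔
      ∀ (i : ℕ) (c : OTree), cs[i]? = some c → Q c := by
    constructor
    · exact fun h i c hi => h c (List.mem_of_getElem? hi)
    · intro h c hc
      obtain ⟨i, hi⟩ := List.mem_iff_getElem?.1 hc
      exact h i c hi
  simp only [goodTrees, Set.mem_ofPred_eq, isPhylogenetic_node, goodFrom_node, everywhere_node,
    hforall]
  constructor
  · rintro ⟨⟨h2, h3⟩, ⟨h4, h5⟩, h6, h7⟩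
    have : cs.length ≠ 0 := by omega
    simp only [this, false_or] at h4
    exact ⟨h2, h4, h6, fun i c hi => ⟨h3 i c hi, h5 i c hi, h7 i c hi⟩⟩
  · rintro ⟨h2, h4, h6, h⟩
    exact ⟨⟨h2, fun i c hi => (h i c hi).1⟩,
      ⟨⟨fun hb => .inr (h4.1 hb), fun hb => .inr (h4.2 hb)⟩, fun i c hi => (h i c hi).2.1⟩,
      h6, fun i c hi => (h i c hi).2.2⟩

/-- Lists of trees from `P` with length `d` that satisfy `ord`. -/
def orderedLists (ord : List OTree → Prop) (P : Set OTree) (d : ℕ) : Set (List OTree) :=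
  {cs | cs.length = d ∧ (∀ c ∈ cs, c ∈ P) ∧ ord cs}

/-- Lists of a tree from `P` and a tree from `Q` that satisfy `ord`. -/
def orderedPairs (ord : List OTree → Prop) (P Q : Set OTree) : Set (List OTree) :=
  {cs | ∃ s ∈ P, ∃ t ∈ Q, cs = [s, t] ∧ ord cs}

/-- One step of the construction of trees whose root has even parity. -/
def evenStep (R : Set ℕ) (ord : List OTree → Prop) (P Q : Set OTree) : Set OTree :=
  Set.range leaf ∪ node '' (orderedPairs ord Q P ∪ ⋃ d ∈ leftEndpoints R, orderedLists ord P d)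

/-- One step of the construction of trees whose root has odd parity. -/
def oddStep (R : Set ℕ) (ord : List OTree → Prop) (P : Set OTree) : Set OTree :=
  Set.range leaf ∪ node '' ⋃ d ∈ rightEndpoints R, orderedLists ord P d

theorem mem_iUnion_orderedLists {D : Set ℕ} {P : Set OTree} {cs : List OTree} :
    cs ∈ ⋃ d ∈ D, orderedLists ord P d ↔ cs.length ∈ D ∧ (∀ c ∈ cs, c ∈ P) ∧ ord cs := by
  simp only [orderedLists, Set.mem_iUnion, Set.mem_ofPred_eq, exists_prop]
  exact ⟨fun ⟨d, hd, hl, h⟩ => ⟨hl ▸ hd, h⟩, fun ⟨hd, h⟩ => ⟨_, hd, rfl, h⟩⟩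

/-- Below a root of odd parity every child is even, including the left child when the root is
binary. -/
theorem node_mem_goodTrees_true (h0 : 0 ∉ R) (hR : NoExposedOdds R) {cs : List OTree} :
    node cs ∈ goodTrees R ord True ↔
      cs ∈ ⋃ d ∈ rightEndpoints R, orderedLists ord (goodTrees R ord False) d := by
  rw [node_mem_goodTrees, mem_iUnion_orderedLists]
  simp only [not_true_eq_false, and_false, false_imp_iff, true_and, true_imp_iff]
  constructor
  · rintro ⟨-, h, ho, hc⟩
    refine ⟨h, fun c hcs => ?_, ho⟩
    obtain ⟨i, hi⟩ := List.mem_iff_getElem?.1 hcs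
    exact hc i c hi
  · rintro ⟨h, hc, ho⟩
    exact ⟨hR.two_le_of_mem_rightEndpoints h0 h, h, ho,
      fun i c hi => hc c (List.mem_of_getElem? hi)⟩

/-- A binary root passes odd parity to its left child only. Since `1 ∈ R` keeps 2 out of
`leftEndpoints R`, all other admissible degrees give even children. -/
theorem node_mem_goodTrees_false (h0 : 0 ∉ R) (h1 : 1 ∈ R) {cs : List OTree} :
    node cs ∈ goodTrees R ord False ↔
      cs ∈ orderedPairs ord (goodTrees R ord True) (goodTrees R ord False) ∪
        ⋃ d ∈ leftEndpoints R, orderedLists ord (goodTrees R ord False) d := by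
  rw [node_mem_goodTrees, Set.mem_union, mem_iUnion_orderedLists]
  simp only [not_false_eq_true, and_true, false_imp_iff, true_imp_iff, orderedPairs,
    Set.mem_ofPred_eq]
  have h2a := NoExposedOdds.two_notMem_leftEndpoints h0 h1
  by_cases hlen : cs.length = 2
  · obtain ⟨s, t, rfl⟩ := List.length_eq_two.1 hlen
    simp only [hlen, h2a, false_and, or_false, le_refl, true_and, and_true]
    constructor
    · rintro ⟨ho, hc⟩
      exact ⟨s, by simpa using hc 0 s rfl, t, by simpa using hc 1 t rfl, rfl, ho⟩
    · rintro ⟨s', hs, t', ht, he, ho⟩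
      obtain ⟨rfl, rfl⟩ : s = s' ∧ t = t' := by simpa using he
      refine ⟨ho, fun i c hi => ?_⟩
      rcases i with _ | _ | i
      · cases hi; simpa using hs
      · cases hi; simpa using ht
      · cases hi
  · simp only [hlen, false_or, and_false]
    constructor
    · rintro ⟨-, h, ho, hc⟩
      refine .inr ⟨h, fun c hcs => ?_, ho⟩
      obtain ⟨i, hi⟩ := List.mem_iff_getElem?.1 hcs
      exact hc i c hi
    · rintro (⟨s, -, t, -, rfl, -⟩ | ⟨h, hc, ho⟩)
      · exact absurd rfl hlen
      · exact ⟨two_le_of_mem_leftEndpoints h0 h, h, ho,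
          fun i c hi => hc c (List.mem_of_getElem? hi)⟩

theorem leaf_mem_range_union (A : Set (List OTree)) (l : ℕ) :
    leaf l ∈ Set.range leaf ∪ node '' A := .inl ⟨l, rfl⟩

theorem node_mem_range_union {A : Set (List OTree)} {cs : List OTree} :
    node cs ∈ Set.range leaf ∪ node '' A ↔ cs ∈ A := by
  simp

theorem goodTrees_false_eq (h0 : 0 ∉ R) (h1 : 1 ∈ R) :
    goodTrees R ord False = evenStep R ord (goodTrees R ord False) (goodTrees R ord True) := by
  ext t
  cases t with
  | leaf l => exact iff_of_true (leaf_mem_goodTrees _ l) (leaf_mem_range_union _ l)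
  | node cs => rw [node_mem_goodTrees_false h0 h1, evenStep, node_mem_range_union]

theorem goodTrees_true_eq (h0 : 0 ∉ R) (hR : NoExposedOdds R) :
    goodTrees R ord True = oddStep R ord (goodTrees R ord False) := by
  ext t
  cases t with
  | leaf l => exact iff_of_true (leaf_mem_goodTrees _ l) (leaf_mem_range_union _ l)
  | node cs => rw [node_mem_goodTrees_true h0 hR, oddStep, node_mem_range_union]

theorem OTree.IsPhylogenetic.labels_ne_zero {t : OTree} (ht : t.IsPhylogenetic) :
    t.labels ≠ 0 := by
  induction t using OTree.induction_children with
  | leaf l => simp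
  | node cs ih =>
    obtain ⟨h2, hcs⟩ := isPhylogenetic_node.1 ht
    rcases cs with _ | ⟨c, cs⟩
    · simp at h2
    · have := ih c (by simp) (hcs c (by simp))
      simp [this]

/-- Some sibling of `c` exists and carries a leaf. This permits recursion on the number of leaves.
-/
theorem card_labels_lt {cs : List OTree} (h : (node cs).IsPhylogenetic) {c : OTree}
    (hc : c ∈ cs) : c.labels.card < (node cs).labels.card := by
  obtain ⟨h2, hcs⟩ := isPhylogenetic_node.1 h
  obtain ⟨as, bs, rfl⟩ := List.append_of_mem hc
  have hpos {t : OTree} (ht : t ∈ as ∨ t ∈ bs) : 0 < t.labels.card :=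
    Multiset.card_pos.2 (hcs t (by
      rcases ht with ht | ht <;> simp [ht])).labels_ne_zero
  rw [labels_node, listLabels_append, listLabels_cons, Multiset.card_add, Multiset.card_add]
  rcases as with _ | ⟨a, as⟩
  · rcases bs with _ | ⟨b, bs⟩
    · simp at h2
    · have := hpos (t := b) (by simp)
      rw [listLabels_cons _ b, Multiset.card_add]
      omega
  · have := hpos (t := a) (by simp)
    rw [listLabels_cons _ a, Multiset.card_add]
    omega

theorem labels_ne_zero_of_mem_goodTrees {b : Prop} : ∀ t ∈ goodTrees R ord b, t.labels ≠ 0 :=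
  fun _ ht => IsPhylogenetic.labels_ne_zero ht.1

/-- The members of a class of trees with fewer than `N` leaves. -/
def below (N : ℕ) (P : Set OTree) : Set OTree := {t | t ∈ P ∧ t.labels.card < N}

/-- Trees with at most N leaves are built from children with fewer than N leaves, so truncated
classes can be constructed one after another. -/
theorem below_succ_range_union {N : ℕ} {b : Prop} {A B : Set (List OTree)}
    (hA : ∀ cs, node cs ∈ goodTrees R ord b ↔ cs ∈ A)
    (hAB : ∀ cs ∈ A, (∀ c ∈ cs, c.labels.card < N) → cs ∈ B) (hBA : B ⊆ A) :
    below (N + 1) (goodTrees R ord b) = below (N + 1) (Set.range leaf ∪ node '' B) := by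
  ext t
  refine and_congr_left fun hcard => ?_
  cases t with
  | leaf l => exact iff_of_true (leaf_mem_goodTrees _ l) (leaf_mem_range_union _ l)
  | node cs =>
    rw [node_mem_range_union]
    refine ⟨fun h => hAB cs ((hA cs).1 h) fun c hc => ?_, fun h => (hA cs).2 (hBA h)⟩
    have := card_labels_lt h.1 hc
    omega

theorem orderedLists_below {N : ℕ} {D : Set ℕ} {P : Set OTree} {cs : List OTree}
    (h : cs ∈ ⋃ d ∈ D, orderedLists ord P d) (hN : ∀ c ∈ cs, c.labels.card < N) :
    cs ∈ ⋃ d ∈ D, orderedLists ord (below N P) d := by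
  rw [mem_iUnion_orderedLists] at h ⊢
  exact ⟨h.1, fun c hc => ⟨h.2.1 c hc, hN c hc⟩, h.2.2⟩

theorem orderedLists_mono {D : Set ℕ} {P Q : Set OTree} (h : P ⊆ Q) :
    ⋃ d ∈ D, orderedLists ord P d ⊆ ⋃ d ∈ D, orderedLists ord Q d := by
  intro cs hcs
  rw [mem_iUnion_orderedLists] at hcs ⊢
  exact ⟨hcs.1, fun c hc => h (hcs.2.1 c hc), hcs.2.2⟩

theorem below_subset (N : ℕ) (P : Set OTree) : below N P ⊆ P := fun _ h => h.1

theorem below_succ_goodTrees_true (h0 : 0 ∉ R) (hR : NoExposedOdds R) (N : ℕ) :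
    below (N + 1) (goodTrees R ord True) =
      below (N + 1) (oddStep R ord (below N (goodTrees R ord False))) :=
  below_succ_range_union (fun _ => node_mem_goodTrees_true h0 hR)
    (fun _ h hN => orderedLists_below h hN) (orderedLists_mono (below_subset _ _))

theorem below_succ_goodTrees_false (h0 : 0 ∉ R) (h1 : 1 ∈ R) (N : ℕ) :
    below (N + 1) (goodTrees R ord False) =
      below (N + 1) (evenStep R ord (below N (goodTrees R ord False))
        (below N (goodTrees R ord True))) := by
  refine below_succ_range_union (fun _ => node_mem_goodTrees_false h0 h1) ?_ ?_
  · rintro cs (⟨s, hs, t, ht, rfl, ho⟩ | h) hN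
    · exact .inl ⟨s, ⟨hs, hN s (by simp)⟩, t, ⟨ht, hN t (by simp)⟩, rfl, ho⟩
    · exact .inr (orderedLists_below h hN)
  · refine Set.union_subset_union ?_ (orderedLists_mono (below_subset _ _))
    rintro cs ⟨s, hs, t, ht, h⟩
    exact ⟨s, hs.1, t, ht.1, h⟩

end Decomposition

/-! ### Generating functions of good trees -/

theorem HasEGF.below {P : Set OTree} {W : ℚ⟦X⟧} (hP : HasEGF P labels W) (N : ℕ) :
    HasEGF (below N P) labels (PowerSeries.mk fun n => if n < N then coeff n W else 0) := by
  intro S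
  rw [coeff_mk]
  have hcard {t : OTree} (h : t.labels = S.val) : t.labels.card = S.card := by rw [h]; rfl
  split_ifs with h
  · have : structuresOn (RestrictedStirling.below N P) labels S = structuresOn P labels S := by
      ext t
      exact ⟨fun ht => ⟨ht.1.1, ht.2⟩, fun ht => ⟨⟨ht.1, by rwa [hcard ht.2]⟩, ht.2⟩⟩
    rw [this]
    exact hP S
  · have : structuresOn (RestrictedStirling.below N P) labels S = ∅ := by
      ext t
      simp only [Set.mem_empty_iff_false, iff_false]
      rintro ⟨⟨-, h1⟩, h2⟩
      rw [hcard h2] at h1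
      exact h h1
    simp [this]

/-- Structures on `S` are already seen in the truncation at `S.card + 1`. -/
theorem HasEGF.of_forall_below {P : Set OTree}
    (h : ∀ N, ∃ W, HasEGF (RestrictedStirling.below N P) labels W) : ∃ W, HasEGF P labels W := by
  choose W hW using h
  refine ⟨PowerSeries.mk fun n => coeff n (W (n + 1)), fun S => ?_⟩
  have : structuresOn P labels S =
      structuresOn (RestrictedStirling.below (S.card + 1) P) labels S := by
    ext t
    refine ⟨fun ht => ⟨⟨ht.1, ?_⟩, ht.2⟩, fun ht => ⟨ht.1.1, ht.2⟩⟩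
    rw [ht.2]
    exact Nat.lt_succ_self _
  rw [coeff_mk, this]
  exact hW _ S

theorem HasEGF.unique {α : Type*} {P : Set α} {s : α → Multiset ℕ} {W V : ℚ⟦X⟧}
    (hW : HasEGF P s W) (hV : HasEGF P s V) : W = V := by
  ext n
  have := (hW (Finset.range n)).2.symm.trans (hV (Finset.range n)).2
  rw [Finset.card_range] at this
  exact mul_left_cancel₀ (by positivity) this

theorem hasEGF_range_leaf : HasEGF (Set.range leaf) labels X := by
  intro S
  by_cases h : S.card = 1
  · obtain ⟨l, rfl⟩ := Finset.card_eq_one.1 h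
    have : structuresOn (Set.range leaf) labels {l} = {leaf l} := by
      ext t
      constructor
      · rintro ⟨⟨l', rfl⟩, h⟩
        simpa using h
      · rintro rfl
        exact ⟨⟨l, rfl⟩, by simp⟩
    simp [this]
  · have : structuresOn (Set.range leaf) labels S = ∅ := by
      ext t
      simp only [Set.mem_empty_iff_false, iff_false]
      rintro ⟨⟨l', rfl⟩, h'⟩
      apply h
      rw [← Finset.card_val, ← h']
      simp
    simp [this, coeff_X, h]

/-- The generating functions of ordered lists of children, for a condition `ord` on such lists. -/
structure IsOrderKind (ord : List OTree → Prop) (c : ℕ → ℚ) (box : ℚ⟦X⟧ → ℚ⟦X⟧ → ℚ⟦X⟧) :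
    Prop where
  lists : ∀ {P : Set OTree} {W : ℚ⟦X⟧}, HasEGF P labels W → (∀ t ∈ P, t.labels ≠ 0) →
    ∀ d, d ≠ 0 → HasEGF (orderedLists ord P d) (listLabels labels) (c d • W ^ d)
  pairs : ∀ {P Q : Set OTree} {V W : ℚ⟦X⟧}, HasEGF P labels V → (∀ t ∈ P, t.labels ≠ 0) →
    HasEGF Q labels W → (∀ t ∈ Q, t.labels ≠ 0) →
    HasEGF (orderedPairs ord P Q) (listLabels labels) (box V W)

section Systems

variable {R : Set ℕ} {ord : List OTree → Prop} {c : ℕ → ℚ} {box : ℚ⟦X⟧ → ℚ⟦X⟧ → ℚ⟦X⟧}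

theorem HasEGF.range_union_node {A : Set (List OTree)} {W : ℚ⟦X⟧}
    (hA : HasEGF A (listLabels labels) W) :
    HasEGF (Set.range leaf ∪ node '' A) labels (X + W) := by
  refine hasEGF_range_leaf.union (hA.image node (fun _ _ => labels_node _)
    (fun a _ b _ h => by simpa using h) rfl) ?_
  rw [Set.disjoint_left]
  rintro _ ⟨l, rfl⟩ ⟨cs, -, h⟩
  cases h

theorem IsOrderKind.iUnion_lists (hk : IsOrderKind ord c box) {P : Set OTree} {W : ℚ⟦X⟧}
    (hP : HasEGF P labels W) (hP0 : ∀ t ∈ P, t.labels ≠ 0) {D : Set ℕ} (hD : 0 ∉ D) :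
    HasEGF (⋃ d ∈ D, orderedLists ord P d) (listLabels labels) ((seriesOn D c).subst W) := by
  refine HasEGF.iUnion_subst (hP.constantCoeff_eq_zero hP0)
    (fun d hd => hk.lists hP hP0 d fun h => hD (h ▸ hd)) fun i j hij => ?_
  exact Set.disjoint_left.2 fun cs hi hj => hij (hi.1.symm.trans hj.1)

theorem IsOrderKind.oddStep (hk : IsOrderKind ord c box) (h0 : 0 ∉ R)
    {P : Set OTree} {W : ℚ⟦X⟧} (hP : HasEGF P labels W) (hP0 : ∀ t ∈ P, t.labels ≠ 0) :
    HasEGF (oddStep R ord P) labels (X + (seriesOn (rightEndpoints R) c).subst W) :=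
  (hk.iUnion_lists hP hP0 fun h => h0 (mem_rightEndpoints.1 h).1).range_union_node

theorem IsOrderKind.evenStep (hk : IsOrderKind ord c box) (h0 : 0 ∉ R) (h1 : 1 ∈ R)
    {P Q : Set OTree} {W V : ℚ⟦X⟧} (hP : HasEGF P labels W) (hP0 : ∀ t ∈ P, t.labels ≠ 0)
    (hQ : HasEGF Q labels V) (hQ0 : ∀ t ∈ Q, t.labels ≠ 0) :
    HasEGF (evenStep R ord P Q) labels
      (X + box V W + (seriesOn (leftEndpoints R) c).subst W) := by
  rw [add_assoc]
  refine ((hk.pairs hQ hQ0 hP hP0).union (hk.iUnion_lists hP hP0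
    fun h => h0 ((mem_leftEndpoints h0).1 h).2.1) ?_).range_union_node
  rw [Set.disjoint_left]
  rintro _ ⟨s, -, t, -, rfl, -⟩ h
  exact NoExposedOdds.two_notMem_leftEndpoints h0 h1 (mem_iUnion_orderedLists.1 h).1

/-- The recursive equations can be read as equations of series only once the classes are known to be
finite on each label set; this induction supplies that. -/
theorem IsOrderKind.exists_below (hk : IsOrderKind ord c box) (h0 : 0 ∉ R) (h1 : 1 ∈ R)
    (hR : NoExposedOdds R) (N : ℕ) :
    (∃ W, HasEGF (below N (goodTrees R ord False)) labels W) ∧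
      ∃ V, HasEGF (below N (goodTrees R ord True)) labels V := by
  induction N with
  | zero =>
    have h (P : Set OTree) : HasEGF (below 0 P) labels 0 := by
      have : below 0 P = ∅ := by ext t; simp [below]
      rw [this]
      intro S
      simp [structuresOn]
    exact ⟨⟨0, h _⟩, 0, h _⟩
  | succ N ih =>
    obtain ⟨⟨W, hW⟩, V, hV⟩ := ih
    have hne (b : Prop) : ∀ t ∈ below N (goodTrees R ord b), t.labels ≠ 0 :=
      fun t ht => labels_ne_zero_of_mem_goodTrees t ht.1
    rw [below_succ_goodTrees_false h0 h1, below_succ_goodTrees_true h0 hR]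
    exact ⟨⟨_, (hk.evenStep h0 h1 hW (hne _) hV (hne _)).below _⟩,
      _, (hk.oddStep h0 hW (hne _)).below _⟩

/-- The generating functions of the good trees satisfy a system of equations. -/
theorem IsOrderKind.exists_system (hk : IsOrderKind ord c box) (h0 : 0 ∉ R) (h1 : 1 ∈ R)
    (hR : NoExposedOdds R) : ∃ E O : ℚ⟦X⟧, HasEGF (goodTrees R ord False) labels E ∧
      constantCoeff E = 0 ∧ E = X + box O E + (seriesOn (leftEndpoints R) c).subst E ∧
      O = X + (seriesOn (rightEndpoints R) c).subst E := by
  obtain ⟨E, hE⟩ := HasEGF.of_forall_below fun N => (hk.exists_below h0 h1 hR N).1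
  obtain ⟨O, hO⟩ := HasEGF.of_forall_below fun N => (hk.exists_below h0 h1 hR N).2
  have hE0 := labels_ne_zero_of_mem_goodTrees (R := R) (ord := ord) (b := False)
  have hO0 := labels_ne_zero_of_mem_goodTrees (R := R) (ord := ord) (b := True)
  refine ⟨E, O, hE, hE.constantCoeff_eq_zero hE0, ?_, ?_⟩
  · have := hk.evenStep h0 h1 hE hE0 hO hO0
    rw [← goodTrees_false_eq h0 h1] at this
    exact hE.unique this
  · have := hk.oddStep h0 hE hE0
    rw [← goodTrees_true_eq h0 hR] at this
    exact hO.unique this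

end Systems

/-! ### The three kinds of orders on siblings -/

/-- Nonempty label sets ensure that `lmax` is an actual label rather than the default value of `sSup
∅`. -/
theorem dominates_lt_iff {s t : OTree} (hs : s.labels ≠ 0) (ht : t.labels ≠ 0) :
    Dominates (· < ·) s.labels t.labels ↔ s.lmax < t.lmax := by
  have hbdd (t : OTree) : BddAbove {l | l ∈ t.leaves} := t.leaves.finite_toSet.bddAbove
  have hmem {t : OTree} (ht : t.labels ≠ 0) : t.lmax ∈ t.labels :=
    Nat.sSup_mem (Multiset.exists_mem_of_ne_zero ht) (hbdd t)
  constructor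
  · rintro ⟨m, hm, h⟩
    exact (h _ (hmem hs)).trans_le (le_csSup (hbdd t) hm)
  · exact fun h => ⟨_, hmem ht, fun l hl => (le_csSup (hbdd s) hl).trans_lt h⟩

theorem dominates_gt_iff {s t : OTree} (hs : s.labels ≠ 0) (ht : t.labels ≠ 0) :
    Dominates (· > ·) s.labels t.labels ↔ t.lmin < s.lmin := by
  have hmem {t : OTree} (ht : t.labels ≠ 0) : t.lmin ∈ t.labels :=
    Nat.sInf_mem (Multiset.exists_mem_of_ne_zero ht)
  constructor
  · rintro ⟨m, hm, h⟩
    exact (Nat.sInf_le hm).trans_lt (h _ (hmem hs))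
  · exact fun h => ⟨_, hmem ht, fun l hl => h.trans_le (Nat.sInf_le hl)⟩

/-- Arbitrary orders on siblings. -/
def anyOrder (_ : List OTree) : Prop := True

/-- Siblings with increasing largest labels. -/
def increasingOrder (cs : List OTree) : Prop := cs.Pairwise fun a b => a.lmax < b.lmax

/-- The left-most sibling has the smallest label. -/
def minFirstOrder (cs : List OTree) : Prop :=
  ∀ c cs', cs = c :: cs' → ∀ b ∈ cs', c.lmin < b.lmin

theorem isOrderKind_anyOrder : IsOrderKind anyOrder (fun _ => 1) fun V W => V * W where
  lists hP _ d _ := by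
    simpa [orderedLists, anyOrder] using hP.lists d
  pairs hP _ hQ _ := by
    refine (hP.prod hQ).image (fun x => [x.1, x.2]) (fun x _ => by simp) ?_ ?_
    · rintro ⟨a, b⟩ - ⟨a', b'⟩ - h
      simpa using h
    · ext cs
      constructor
      · rintro ⟨⟨s, t⟩, ⟨hs, ht⟩, rfl⟩
        exact ⟨s, hs, t, ht, rfl, trivial⟩
      · rintro ⟨s, hs, t, ht, rfl, -⟩
        exact ⟨(s, t), ⟨hs, ht⟩, rfl⟩

theorem isOrderKind_increasingOrder : IsOrderKind increasingOrder
    (fun d => 1 / (d.factorial : ℚ)) fun V W => antideriv (V * d⁄dX ℚ W) where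
  lists {P W} hP h0 d _ := by
    have h := hP.lists_pairwise_dominates hasTops_lt h0 d
    convert h using 1
    ext cs
    refine and_congr_right fun _ => and_congr_right fun hcs => ⟨fun h => ?_, fun h => ?_⟩
    · exact List.Pairwise.imp_of_mem
        (fun ha hb hab => (dominates_lt_iff (h0 _ (hcs _ ha)) (h0 _ (hcs _ hb))).2 hab) h
    · exact List.Pairwise.imp_of_mem
        (fun ha hb hab => (dominates_lt_iff (h0 _ (hcs _ ha)) (h0 _ (hcs _ hb))).1 hab) h
  pairs hP hP0 hQ hQ0 := by
    refine (hP.prod_boxed hasTops_lt hQ).image (fun x => [x.1, x.2]) (fun x _ => by simp) ?_ ?_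
    · rintro ⟨a, b⟩ - ⟨a', b'⟩ - h
      simpa using h
    · ext cs
      constructor
      · rintro ⟨⟨s, t⟩, ⟨⟨hs, ht⟩, hd⟩, rfl⟩
        exact ⟨s, hs, t, ht, rfl, by
          simpa [increasingOrder] using (dominates_lt_iff (hP0 s hs) (hQ0 t ht)).1 hd⟩
      · rintro ⟨s, hs, t, ht, rfl, h⟩
        exact ⟨(s, t), ⟨⟨hs, ht⟩, (dominates_lt_iff (hP0 s hs) (hQ0 t ht)).2
          (by simpa [increasingOrder] using h)⟩, rfl⟩

theorem isOrderKind_minFirstOrder : IsOrderKind minFirstOrder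
    (fun d => 1 / (d : ℚ)) fun V W => antideriv (d⁄dX ℚ V * W) where
  lists {P W} hP h0 d hd := by
    -- The case d = 0 must be excluded: the empty list is vacuously min-first, but `1 / 0 = 0`.
    obtain ⟨d, rfl⟩ := Nat.exists_eq_succ_of_ne_zero hd
    have h := hP.lists_head_dominates hasTops_gt h0 d
    convert h using 1
    ext cs
    refine and_congr_right fun _ => and_congr_right fun hcs => forall_congr' fun c =>
      forall_congr' fun cs' => forall_congr' fun he =>
      forall_congr' fun b => forall_congr' fun hb => ?_
    subst he
    exact (dominates_gt_iff (h0 _ (hcs b (by simp [hb]))) (h0 _ (hcs c (by simp)))).symm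
  pairs {P Q V W} hP hP0 hQ hQ0 := by
    -- The left tree holds the minimum, so it must be the second, boxed component; the pair is
    -- swapped back when forming the list.
    rw [mul_comm]
    refine (hQ.prod_boxed hasTops_gt hP).image (fun x => [x.2, x.1])
      (fun x _ => by simp [add_comm]) ?_ ?_
    · rintro ⟨a, b⟩ - ⟨a', b'⟩ - h
      simpa [and_comm] using h
    · ext cs
      constructor
      · rintro ⟨⟨t, s⟩, ⟨⟨ht, hs⟩, hd⟩, rfl⟩
        refine ⟨s, hs, t, ht, rfl, ?_⟩
        rintro c cs' he
        obtain ⟨rfl, rfl⟩ := List.cons.inj he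
        simpa using (dominates_gt_iff (hQ0 t ht) (hP0 s hs)).1 hd
      · rintro ⟨s, hs, t, ht, rfl, h⟩
        exact ⟨(t, s), ⟨⟨ht, hs⟩, (dominates_gt_iff (hQ0 t ht) (hP0 s hs)).2
          (h s [t] rfl t (by simp))⟩, rfl⟩

end RestrictedStirling

namespace RestrictedStirling

open PowerSeries OTree

/-! ### Blocks: sets, cycles and lists of labels -/

theorem ncard_lists_on (S : Finset ℕ) :
    {l : List ℕ | (l : Multiset ℕ) = S.val}.Finite ∧
      {l : List ℕ | (l : Multiset ℕ) = S.val}.ncard = S.card.factorial := by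
  have : {l : List ℕ | (l : Multiset ℕ) = S.val} = (S.toList.permutations.toFinset : Set _) := by
    ext l
    rw [Set.mem_ofPred_eq, Finset.mem_coe, List.mem_toFinset, List.mem_permutations,
      ← Finset.coe_toList S, Multiset.coe_eq_coe]
  rw [this, Set.ncard_coe_finset, List.toFinset_card_of_nodup
    (List.nodup_permutations _ S.nodup_toList), List.length_permutations, Finset.length_toList]
  exact ⟨Finset.finite_toSet _, rfl⟩

theorem coeff_seriesOn_of_mem {D : Set ℕ} {c : ℕ → ℚ} {n : ℕ} (h : n ∈ D) :
    coeff n (seriesOn D c) = c n := by simp [h]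

theorem hasEGF_of_card {α : Type*} {P : Set α} {s : α → Multiset ℕ} {R : Set ℕ} {c : ℕ → ℚ}
    (hmem : ∀ S : Finset ℕ, S.card ∈ R → (structuresOn P s S).Finite ∧
      ((structuresOn P s S).ncard : ℚ) = S.card.factorial * c S.card)
    (hP : ∀ a ∈ P, (s a).card ∈ R) : HasEGF P s (seriesOn R c) := by
  intro S
  by_cases h : S.card ∈ R
  · rw [coeff_seriesOn_of_mem h]
    exact hmem S h
  · have : structuresOn P s S = ∅ := by
      ext a
      simp only [Set.mem_empty_iff_false, iff_false]
      rintro ⟨ha, hS⟩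
      exact h (by simpa [hS] using hP a ha)
    simp [this, h]

theorem hasEGF_sets (R : Set ℕ) :
    HasEGF {B : Finset ℕ | B.card ∈ R} Finset.val
      (seriesOn R fun r => 1 / (r.factorial : ℚ)) := by
  refine hasEGF_of_card (fun S hS => ?_) fun B hB => hB
  have : structuresOn {B : Finset ℕ | B.card ∈ R} Finset.val S = {S} := by
    ext B
    constructor
    · exact fun h => Finset.val_injective h.2
    · rintro rfl
      exact ⟨hS, rfl⟩
  rw [this]
  have : (S.card.factorial : ℚ) ≠ 0 := by positivity
  simp [this]

theorem hasEGF_lists {R : Set ℕ} (h0 : 0 ∉ R) :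
    HasEGF {l : List ℕ | l ≠ [] ∧ l.length ∈ R} (fun l => (l : Multiset ℕ))
      (seriesOn R fun _ => 1) := by
  refine hasEGF_of_card (fun S hS => ?_) fun l hl => by simpa using hl.2
  have : structuresOn {l : List ℕ | l ≠ [] ∧ l.length ∈ R} (fun l => (l : Multiset ℕ)) S =
      {l : List ℕ | (l : Multiset ℕ) = S.val} := by
    ext l
    refine ⟨fun h => h.2, fun h => ⟨?_, h⟩⟩
    have hl : l.length ∈ R := by
      rwa [← Multiset.coe_card, show (l : Multiset ℕ) = S.val from h]
    exact ⟨by rintro rfl; exact h0 hl, hl⟩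
  rw [this, (ncard_lists_on S).2, mul_one]
  exact ⟨(ncard_lists_on S).1, rfl⟩

/-- Without repeated entries, a rotation that keeps the first entry is trivial. -/
theorem eq_of_isRotated_cons {m : ℕ} {l l' : List ℕ} (hnd : (m :: l).Nodup)
    (h : (m :: l) ~r (m :: l')) : l = l' := by
  obtain ⟨n, hn⟩ := h
  rw [← List.rotate_mod] at hn
  have hlt : n % (m :: l).length < (m :: l).length := Nat.mod_lt _ (by simp)
  have hhead := List.head?_rotate hlt
  rw [hn, List.head?_cons, List.getElem?_eq_getElem hlt, Option.some_inj] at hhead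
  have h0 : (m :: l)[0] = (m :: l)[n % (m :: l).length] := hhead
  rw [hnd.getElem_inj_iff] at h0
  rw [← h0, List.rotate_zero] at hn
  exact (List.cons.inj hn).2

/-- Cutting a cycle at a fixed label `m` leaves an arbitrary list of the other labels, hence (n-1)!
= n!/n cycles. -/
theorem hasEGF_cycles {R : Set ℕ} (h0 : 0 ∉ R) :
    HasEGF {c : Cycle ℕ | c ≠ Cycle.nil ∧ c.length ∈ R} Cycle.toMultiset
      (seriesOn R fun r => 1 / (r : ℚ)) := by
  refine hasEGF_of_card (fun S hS => ?_) fun c hc => by simpa using hc.2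
  obtain ⟨m, hm⟩ : S.Nonempty := by
    rw [Finset.nonempty_iff_ne_empty]
    rintro rfl
    exact h0 hS
  have hbij : Set.BijOn (fun l : List ℕ => ((m :: l : List ℕ) : Cycle ℕ))
      {l : List ℕ | (l : Multiset ℕ) = (S.erase m).val}
      (structuresOn {c : Cycle ℕ | c ≠ Cycle.nil ∧ c.length ∈ R} Cycle.toMultiset S) := by
    have hval {l : List ℕ} (hl : (l : Multiset ℕ) = (S.erase m).val) :
        ((m :: l : List ℕ) : Multiset ℕ) = S.val := by
      rw [← Multiset.cons_coe, hl, Finset.erase_val, Multiset.cons_erase hm]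
    refine ⟨fun l hl => ?_, fun l hl l' hl' h => ?_, ?_⟩
    · refine ⟨⟨?_, ?_⟩, hval hl⟩
      · rw [Ne, ← Cycle.toMultiset_eq_nil, Cycle.coe_toMultiset]
        exact (Multiset.coe_eq_zero _).not.2 (by simp)
      · rw [← Cycle.card_toMultiset, Cycle.coe_toMultiset, hval hl]
        exact hS
    · have hnd : (m :: l).Nodup := by
        rw [← Multiset.coe_nodup, hval hl]
        exact S.nodup
      exact eq_of_isRotated_cons hnd (Cycle.coe_eq_coe.1 h)
    · rintro c ⟨-, hc⟩
      induction c using Quotient.inductionOn' with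
      | h l =>
        have hl : (l : Multiset ℕ) = S.val := hc
        have hml : m ∈ l := by
          rw [← Multiset.mem_coe, hl]
          exact hm
        obtain ⟨as, bs, rfl⟩ := List.append_of_mem hml
        refine ⟨bs ++ as, ?_, ?_⟩
        · rw [Set.mem_ofPred_eq, Finset.erase_val, ← hl]
          have : ((as ++ m :: bs : List ℕ) : Multiset ℕ) =
              ((m :: (bs ++ as) : List ℕ) : Multiset ℕ) :=
            Multiset.coe_eq_coe.2 List.perm_append_comm
          rw [this]
          simp
        · exact Cycle.coe_eq_coe.2 (List.isRotated_append (l := m :: bs) (l' := as))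
  have hcard : (S.erase m).card + 1 = S.card := Finset.card_erase_add_one hm
  rw [← hbij.image_eq, hbij.injOn.ncard_image, (ncard_lists_on _).2]
  refine ⟨(ncard_lists_on _).1.image _, ?_⟩
  rw [← hcard, Nat.factorial_succ]
  push_cast
  field_simp

/-! ### Assemblies of blocks and trees -/

/-- A sum of label sets without repetition forces disjointness, and then sum and supremum agree. -/
theorem sum_val_eq_iff {C : Finset (Finset ℕ)} {S : Finset ℕ} :
    ∑ B ∈ C, B.val = S.val ↔ (C : Set (Finset ℕ)).PairwiseDisjoint id ∧ C.sup id = S := by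
  have hsup : C.sup Finset.val = (C.sup id).val := by
    induction C using Finset.induction_on with
    | empty => rfl
    | insert B C _ ih =>
      rw [Finset.sup_insert, Finset.sup_insert, ih]
      exact (Finset.union_val _ _).symm
  have hdis : ∑ B ∈ C, B.val = C.sup Finset.val ↔ (C : Set (Finset ℕ)).PairwiseDisjoint id := by
    rw [Multiset.finsetSum_eq_sup_iff_disjoint]
    constructor
    · intro h B hB B' hB' hne
      exact Finset.disjoint_val.1 (h B hB B' hB' hne)
    · intro h B hB B' hB' hne
      exact Finset.disjoint_val.2 (h hB hB' hne)
  constructor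
  · intro h
    have hd : (C : Set (Finset ℕ)).PairwiseDisjoint id := by
      intro B hB B' hB' hne
      rw [← Finset.add_sum_erase _ _ hB] at h
      refine Finset.disjoint_left.2 fun x hx hx' => notMem_of_add_eq_val h x hx ?_
      exact Multiset.mem_sum.2 ⟨B', Finset.mem_erase.2 ⟨hne.symm, hB'⟩, hx'⟩
    exact ⟨hd, Finset.val_injective (by rw [← hsup, ← hdis.2 hd, h])⟩
  · rintro ⟨hd, hS⟩
    rw [hdis.2 hd, hsup, hS]

theorem stirlingSecond_eq {R : Set ℕ} (h0 : 0 ∉ R) (n k : ℕ) :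
    (stirlingSecond R n k : ℚ) = n.factorial * coeff n
      ((1 / (k.factorial : ℚ)) • (seriesOn R fun r => 1 / (r.factorial : ℚ)) ^ k) := by
  have h := ((hasEGF_sets R).finsets (fun B hB => by
    rw [Ne, Finset.val_eq_zero]
    rintro rfl
    exact h0 hB) k (Finset.Icc 1 n)).2
  rw [Nat.card_Icc, Nat.add_sub_cancel] at h
  rw [← h, stirlingSecond, ← Set.ncard_image_of_injective _
    (f := fun P : Finpartition (Finset.Icc 1 n) => P.parts) fun P P' => Finpartition.ext]
  congr 2
  ext C
  constructor
  · rintro ⟨P, ⟨hk, hR⟩, rfl⟩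
    exact ⟨⟨hk, hR⟩, sum_val_eq_iff.2
      ⟨P.supIndep.pairwiseDisjoint, P.sup_parts⟩⟩
  · rintro ⟨⟨hk, hR⟩, hS⟩
    obtain ⟨hd, hsup⟩ := sum_val_eq_iff.1 hS
    exact ⟨⟨C, Finset.supIndep_iff_pairwiseDisjoint.2 hd, hsup, fun h => h0 (hR _ h)⟩,
      ⟨hk, hR⟩, rfl⟩

theorem stirlingFirst_eq {R : Set ℕ} (h0 : 0 ∉ R) (n k : ℕ) :
    (stirlingFirst R n k : ℚ) = n.factorial * coeff n
      ((1 / (k.factorial : ℚ)) • (seriesOn R fun r => 1 / (r : ℚ)) ^ k) := by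
  have h := ((hasEGF_cycles h0).finsets (fun c hc => by
    rw [Ne, Cycle.toMultiset_eq_nil]
    exact hc.1) k (Finset.Icc 1 n)).2
  rw [Nat.card_Icc, Nat.add_sub_cancel] at h
  rw [← h, stirlingFirst]
  congr 2
  ext C
  exact and_assoc.symm

theorem lah_eq {R : Set ℕ} (h0 : 0 ∉ R) (n k : ℕ) :
    (lah R n k : ℚ) = n.factorial * coeff n
      ((1 / (k.factorial : ℚ)) • (seriesOn R fun _ => 1) ^ k) := by
  have h := ((hasEGF_lists h0).finsets (fun l hl => (Multiset.coe_eq_zero _).not.2 hl.1) k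
    (Finset.Icc 1 n)).2
  rw [Nat.card_Icc, Nat.add_sub_cancel] at h
  rw [← h, lah]
  congr 2
  ext C
  exact and_assoc.symm

theorem ncard_forests_eq {R : Set ℕ} {ord : List OTree → Prop} {E : ℚ⟦X⟧}
    (hE : HasEGF (goodTrees R ord False) labels E) (n k : ℕ) :
    ({F | F ∈ goodForestsLinear R n k ∧ ∀ t ∈ F, t.Everywhere ord}.ncard : ℚ) =
      n.factorial * coeff n ((1 / (k.factorial : ℚ)) • E ^ k) := by
  have h := (hE.finsets labels_ne_zero_of_mem_goodTrees k (Finset.Icc 1 n)).2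
  rw [Nat.card_Icc, Nat.add_sub_cancel] at h
  rw [← h]
  congr 2
  ext F
  constructor
  · rintro ⟨⟨⟨hk, hph, hS⟩, hg⟩, ho⟩
    exact ⟨⟨hk, fun t ht => ⟨hph t ht, isGood_iff.1 (hg t ht), ho t ht⟩⟩, hS⟩
  · rintro ⟨⟨hk, ht⟩, hS⟩
    exact ⟨⟨⟨hk, fun t h => (ht t h).1, hS⟩, fun t h => isGood_iff.2 (ht t h).2.1⟩,
      fun t h => (ht t h).2.2⟩

theorem goodForestsLinear_eq (R : Set ℕ) (n k : ℕ) : goodForestsLinear R n k =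
    {F | F ∈ goodForestsLinear R n k ∧ ∀ t ∈ F, t.Everywhere anyOrder} := by
  ext F
  exact ⟨fun h => ⟨h, fun _ _ _ _ _ => trivial⟩, fun h => h.1⟩

theorem goodForestsMinFirst_eq (R : Set ℕ) (n k : ℕ) : goodForestsMinFirst R n k =
    {F | F ∈ goodForestsLinear R n k ∧ ∀ t ∈ F, t.Everywhere minFirstOrder} := by
  ext F
  refine and_congr_right fun _ => forall₂_congr fun t _ => ⟨?_, ?_⟩
  · rintro h p _ hp c cs rfl
    exact h p c cs hp
  · intro h p c cs hp
    exact h p _ hp c cs rfl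

/-! ### Infinite triangular matrices -/

section Triangular

variable {A B C : Matrix ℕ+ ℕ+ ℚ}

theorem isProduct_iff (hA : ∀ n j, n < j → A n j = 0) :
    IsProduct A B C ↔ ∀ n k, ∑ j ∈ Finset.Iic n, A n j * B j k = C n k := by
  have hsub (n k : ℕ+) : (Function.support fun j => A n j * B j k) ⊆
      (Finset.Iic n : Finset ℕ+) := by
    intro j hj
    rw [Finset.coe_Iic, Set.mem_Iic]
    by_contra! hlt
    exact hj (by simp [hA n j hlt])
  refine forall₂_congr fun n k => ?_
  rw [finsum_eq_sum_of_support_subset _ (hsub n k)]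
  exact and_iff_right ((Finset.finite_toSet _).subset (hsub n k))

/-- Truncation to indices at most N respects products of lower triangular matrices, and finite
square one-sided inverses are two-sided. -/
theorem IsProduct.comm_of_triangular (hA : ∀ n j, n < j → A n j = 0)
    (hB : ∀ n j, n < j → B n j = 0) (h : IsProduct A B 1) : IsProduct B A 1 := by
  rw [isProduct_iff hA] at h
  rw [isProduct_iff hB]
  intro n k
  set N := max n k
  let trunc (M : Matrix ℕ+ ℕ+ ℚ) : Matrix (Finset.Iic N) (Finset.Iic N) ℚ :=
    M.submatrix Subtype.val Subtype.val
  have hmul {M M' : Matrix ℕ+ ℕ+ ℚ} (hM : ∀ n j, n < j → M n j = 0) (i l : Finset.Iic N) :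
      (trunc M * trunc M') i l = ∑ j ∈ Finset.Iic i.1, M i j * M' j l := by
    rw [Matrix.mul_apply]
    simp only [trunc, Matrix.submatrix_apply]
    rw [Finset.sum_coe_sort (Finset.Iic N) (fun j => M i j * M' j l)]
    refine (Finset.sum_subset (Finset.Iic_subset_Iic.2 (Finset.mem_Iic.1 i.2)) ?_).symm
    intro j _ hj
    rw [hM i j (by simpa using hj), zero_mul]
  have hone (i l : Finset.Iic N) : (1 : Matrix ℕ+ ℕ+ ℚ) i l =
      (1 : Matrix (Finset.Iic N) (Finset.Iic N) ℚ) i l := by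
    simp only [Matrix.one_apply, Subtype.ext_iff]
  have hAB : trunc A * trunc B = 1 := by
    ext i l
    rw [hmul hA, h, hone]
  have hBA := mul_eq_one_comm.1 hAB
  let n' : Finset.Iic N := ⟨n, Finset.mem_Iic.2 (le_max_left _ _)⟩
  let k' : Finset.Iic N := ⟨k, Finset.mem_Iic.2 (le_max_right _ _)⟩
  have := hmul hB n' k' (M' := A)
  rw [hBA] at this
  exact this.symm.trans (hone n' k').symm

/-- Forward substitution: row n of the inverse is determined by the earlier rows, because the
diagonal entries are 1. -/
theorem IsProduct.right_unique (hA : ∀ n j, n < j → A n j = 0) (hA1 : ∀ n, A n n = 1)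
    (hB : IsProduct A B 1) (hC : IsProduct A C 1) (n k : ℕ+) : B n k = C n k := by
  rw [isProduct_iff hA] at hB hC
  induction n using PNat.strongInductionOn with
  | _ n ih =>
    have h := (hB n k).trans (hC n k).symm
    rw [← Finset.Iio_insert, Finset.sum_insert (by simp), Finset.sum_insert (by simp), hA1,
      Finset.sum_congr rfl fun j hj => by rw [ih j (Finset.mem_Iio.1 hj)]] at h
    simpa using h

end Triangular

/-! ### From compositional inverses to matrix inverses -/

theorem coeff_pow_of_lt {f : ℚ⟦X⟧} (hf : constantCoeff f = 0) {n k : ℕ} (h : n < k) :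
    coeff n (f ^ k) = 0 := by
  apply coeff_of_lt_order
  exact lt_of_lt_of_le (by exact_mod_cast h) (le_order_pow_of_constantCoeff_eq_zero k hf)

theorem coeff_pow_self {f : ℚ⟦X⟧} (hf : constantCoeff f = 0) (n : ℕ) :
    coeff n (f ^ n) = coeff 1 f ^ n := by
  obtain ⟨g, rfl⟩ := X_dvd_iff.2 hf
  have := coeff_succ_X_mul 0 g
  rw [zero_add] at this
  rw [mul_pow, coeff_X_pow_mul', if_pos le_rfl, Nat.sub_self, this,
    coeff_zero_eq_constantCoeff_apply, coeff_zero_eq_constantCoeff_apply, map_pow]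

theorem neg_one_zpow_sub (n k : ℕ) :
    (-1 : ℚ) ^ ((n : ℤ) - (k : ℤ)) = (-1) ^ n * (-1) ^ k := by
  rw [zpow_sub₀ (by norm_num), zpow_natCast, zpow_natCast, div_eq_iff (by simp), mul_assoc,
    ← mul_pow]
  norm_num

/-- Matrices given by powers of exponential generating functions that are inverse under
composition, up to signs, are inverse to each other, up to signs. -/
theorem inverse_of_subst_eq {a g : ℕ → ℕ → ℕ} {f E : ℚ⟦X⟧} (hf : constantCoeff f = 0)
    (hf1 : coeff 1 f = 1) (hE : constantCoeff E = 0)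
    (ha : ∀ n k, (a n k : ℚ) = n.factorial * coeff n ((1 / (k.factorial : ℚ)) • f ^ k))
    (hg : ∀ n k, (g n k : ℚ) = n.factorial * coeff n ((1 / (k.factorial : ℚ)) • E ^ k))
    (hsub : f.subst (-E) = -X) :
    (∃ B, IsInverse (infMatrix a) B) ∧ ∀ B, IsInverse (infMatrix a) B → ∀ n k : ℕ+,
      B n k = (-1 : ℚ) ^ ((n : ℤ) - (k : ℤ)) * (g n k : ℚ) := by
  let G : Matrix ℕ+ ℕ+ ℚ := Matrix.of fun n k => (-1 : ℚ) ^ ((n : ℤ) - (k : ℤ)) * (g n k : ℚ)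
  have hA : ∀ n j, n < j → infMatrix a n j = 0 := fun n j hlt => by
    have : (n : ℕ) < j := hlt
    simp [infMatrix, ha, coeff_pow_of_lt hf this]
  have hA1 : ∀ n, infMatrix a n n = 1 := fun n => by
    have : ((n : ℕ).factorial : ℚ) ≠ 0 := by positivity
    simp [infMatrix, ha, coeff_pow_self hf, hf1, this]
  have hG : ∀ n j, n < j → G n j = 0 := fun n j hlt => by
    have : (n : ℕ) < j := hlt
    simp [G, hg, coeff_pow_of_lt hE this]
  have hGA : IsProduct G (infMatrix a) 1 := by
    have hs := hasSubst_neg hE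
    intro n k
    refine ⟨(Set.finite_Iic n).subset fun j hj => ?_, ?_⟩
    · by_contra! hlt
      exact hj (by simp [hG n j (not_le.1 hlt)])
    have hk : coeff 0 (f ^ (k : ℕ)) = 0 := coeff_pow_of_lt hf k.pos
    -- Expanding f(-E)^k = (-X)^k at degree n gives, up to factorials and signs, the (n,k) entry of
    -- the product `G` times `infMatrix a`.
    have key := coeff_subst' hs (f ^ (k : ℕ)) n
    rw [subst_pow hs, hsub, neg_pow, ← map_one (C (R := ℚ)), ← map_neg, ← map_pow, coeff_C_mul,
      coeff_X_pow] at key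
    -- The indices of the matrices start at 1; the extra term d = 0 vanishes since k is positive.
    have hrange : ∑ᶠ d : ℕ, coeff d (f ^ (k : ℕ)) • coeff n ((-E) ^ d) =
        ∑ᶠ j : ℕ+, coeff (j : ℕ) (f ^ (k : ℕ)) • coeff n ((-E) ^ (j : ℕ)) := by
      rw [← finsum_mem_range (f := fun d => coeff d (f ^ (k : ℕ)) • coeff n ((-E) ^ d))
        PNat.coe_injective]
      refine finsum_congr fun d => ?_
      rcases Nat.eq_zero_or_pos d with rfl | hd
      · simp only [hk, zero_smul, finsum_zero]
      · have : d ∈ Set.range ((↑) : ℕ+ → ℕ) := ⟨⟨d, hd⟩, rfl⟩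
        simp only [this, finsum_true]
    rw [hrange] at key
    have hterm (j : ℕ+) : G n j * infMatrix a j k =
        ((-1) ^ (n : ℕ) * (n : ℕ).factorial / (k : ℕ).factorial) *
          (coeff (j : ℕ) (f ^ (k : ℕ)) • coeff n ((-E) ^ (j : ℕ))) := by
      have h1 : ((j : ℕ).factorial : ℚ) ≠ 0 := by positivity
      simp only [G, infMatrix, Matrix.of_apply, hg, ha, map_smul, smul_eq_mul]
      rw [neg_pow E, ← map_one (C (R := ℚ)), ← map_neg, ← map_pow, coeff_C_mul]
      have h2 := neg_one_zpow_sub n j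
      rw [h2]
      field_simp
    rw [finsum_congr hterm, ← mul_finsum', ← key, Matrix.one_apply]
    · by_cases hnk : n = k
      · subst hnk
        have h1 : ((n : ℕ).factorial : ℚ) ≠ 0 := by positivity
        have h2 : ((-1 : ℚ)) ^ (n : ℕ) * (-1) ^ (n : ℕ) = 1 := by rw [← mul_pow]; norm_num
        simp only [if_true, mul_one]
        rw [mul_div_assoc, div_self h1, mul_one, h2]
      · have : (n : ℕ) ≠ k := fun h => hnk (PNat.coe_injective h)
        simp [hnk, this]
    · refine (Set.finite_Iic n).subset fun j hj => ?_
      by_contra! hlt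
      exact hj (by
        dsimp only
        rw [coeff_pow_of_lt (by simp [hE]) (PNat.coe_lt_coe _ _ |>.2 (not_le.1 hlt)), smul_zero])
  have hAG := hGA.comm_of_triangular hG hA
  exact ⟨⟨G, hAG, hGA⟩, fun B hB n k => IsProduct.right_unique hA hA1 hB.1 hAG n k⟩

end RestrictedStirling

/-! ### The main theorem -/

open RestrictedStirling in
theorem theorem3p1 (R : Set ℕ) (hpos : ∀ r ∈ R, 1 ≤ r) (h1 : 1 ∈ R) (hR : NoExposedOdds R) :
    ((∃ B, IsInverse (infMatrix (stirlingSecond R)) B) ∧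
      ∀ B, IsInverse (infMatrix (stirlingSecond R)) B → ∀ n k : ℕ+,
        B n k = (-1 : ℚ) ^ ((n : ℤ) - (k : ℤ)) * ((goodForestsIncreasing R n k).ncard : ℚ)) ∧
    ((∃ B, IsInverse (infMatrix (stirlingFirst R)) B) ∧
      ∀ B, IsInverse (infMatrix (stirlingFirst R)) B → ∀ n k : ℕ+,
        B n k = (-1 : ℚ) ^ ((n : ℤ) - (k : ℤ)) * ((goodForestsMinFirst R n k).ncard : ℚ)) ∧
    ((∃ B, IsInverse (infMatrix (lah R)) B) ∧
      ∀ B, IsInverse (infMatrix (lah R)) B → ∀ n k : ℕ+,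
        B n k = (-1 : ℚ) ^ ((n : ℤ) - (k : ℤ)) * ((goodForestsLinear R n k).ncard : ℚ)) := by
  have h0 : 0 ∉ R := fun h => absurd (hpos 0 h) (by norm_num)
  refine ⟨?_, ?_, ?_⟩
  · obtain ⟨E, O, hE, hE0, hsE, hsO⟩ := isOrderKind_increasingOrder.exists_system h0 h1 hR
    exact inverse_of_subst_eq (by simp [h0]) (by simp [h1]) hE0 (stirlingSecond_eq h0)
      -- No rewriting is needed: `IsIncreasing` is definitionally `Everywhere increasingOrder`.
      (g := fun n k => (goodForestsIncreasing R n k).ncard) (ncard_forests_eq hE)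
      (subst_neg_eq_neg_X_of_maxBoxed h0 h1 hR hE0 hsE hsO)
  · obtain ⟨E, O, hE, hE0, hsE, hsO⟩ := isOrderKind_minFirstOrder.exists_system h0 h1 hR
    exact inverse_of_subst_eq (by simp [h0]) (by simp [h1]) hE0 (stirlingFirst_eq h0)
      (g := fun n k => (goodForestsMinFirst R n k).ncard)
      (fun n k => by rw [goodForestsMinFirst_eq]; exact ncard_forests_eq hE n k)
      (subst_neg_eq_neg_X_of_minBoxed h0 h1 hR hE0 hsE hsO)
  · obtain ⟨E, O, hE, hE0, hsE, hsO⟩ := isOrderKind_anyOrder.exists_system h0 h1 hR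
    exact inverse_of_subst_eq (by simp [h0]) (by simp [h1]) hE0 (lah_eq h0)
      (g := fun n k => (goodForestsLinear R n k).ncard)
      (fun n k => by rw [goodForestsLinear_eq]; exact ncard_forests_eq hE n k)
      (subst_neg_eq_neg_X_of_linear h0 h1 hR hE0 hsE hsO)
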